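/- **Model.** Time is slotted. Let $A,S,Q$ be integers with $1\le A\le S$ and $A\le Q$, and let $0<\alpha<1$. A buffer holds $q[n]\in\{0,\dots,Q\}$ packets at the beginning of timeslot $n$. In timeslot $n$, $s[n]\in\{0,\dots,S\}$ packets are transmitted, subject to $0\le q[n]-s[n]\le Q-A$, and then, independently with probability $\alpha$, $A$ packets arrive: $q[n+1]=q[n]-s[n]+A$ with probability $\alpha$ and $q[n+1]=q[n]-s[n]$ with probability $1-\alpha$. Transmitting $s$ packets costs power $P_s$, where $P_0=0$ and $P_s$ is strictly increasing and convex in $s\in\{0,\dots,S\}$. A (feasible) policy $\gamma$ chooses $s[n]$ at random, with a distribution that depends on $q[1],s[1],\dots,s[n-1],q[n]$ and is concentrated on the admissible actions. For an initial state $q[1]=q_0$, its average power and average delay are $$P_\gamma=\lim_{N\to\infty}\frac1N\,\mathrm E^{\gamma}_{q_0}\Big\{\sum_{n=1}^N P_{s[n]}\Big\},\qquad D_\gamma=\frac1{\alpha A}\lim_{N\to\infty}\frac1N\,\mathrm E^{\gamma}_{q_0}\Big\{\sum_{n=1}^N q[n]\Big\}.$$ Let $\mathcal R$ be the set of the points $(P_\gamma,D_\gamma)$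 for all policies $\gamma$ for which both limits exist, and let the optimal delay-power tradeoff curve be $$\mathcal L=\{(P,D)\in\mathcal R:\ \text{for all }(P',D')\in\mathcal R,\ P'\ge P\text{ or }D'\ge D\}.$$ A deterministic policy transmits, in each state $q$, a fixed admissible number $s(q)$ of packets; it *obtains* a point $Z$ of the plane if $(P_\gamma,D_\gamma)=Z$ for every initial state. **Corollary 3.** The curve $\mathcal L$ is decreasing (if $(P_1,D_1),(P_2,D_2)\in\mathcal L$ and $P_1<P_2$, then $D_1>D_2$), convex (the set $\{(P,D): (P,D')\in\mathcal L\text{ for some }D'\le D\}$ is convex), and piecewise linear, and it does not depend on $q_0$. More precisely, there are $n\ge 0$ and points $Z_0,\dots,Z_n$, called the vertices, with strictly increasing delays and nonincreasing powers, such that $\mathcal L$ is the polygonal chain consisting of the segments $\overline{Z_iZ_{i+1}}$, $0\le i<n$ (the point $Z_0$ if $n=0$), and such that 1. every corner of $\mathcal L$ (every point of $\mathcal L$ that is not in the interior of a nondegenerate line segment contained in $\mathcal L$) is one of the $Z_i$; 2. every vertex $Z_i$ is obtained by a deterministic policy; 3. for every $0\le i<n$, the neighbouring vertices $Z_i$ and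 $Z_{i+1}$ are obtained by deterministic policies that take different actions in exactly one state. (Some vertices may lie in the interior of a straight piece of $\mathcal L$.) -/

import Mathlib

open Filter Topology

/-- The parameters of the buffer-aware scheduling model, with the standing assumptions on them.
Each arrival brings `A` packets and occurs in a timeslot with probability `α`; at most `S` packets
are transmitted per timeslot, the buffer holds at most `Q` packets, and transmitting `s` packets
costs power `P s` (only the values `P 0, …, P S` are relevant). -/
structure BufferModel where
  A : ℕ
  S : ℕ
  Q : ℕ
  α : ℝ
  P : ℕ → ℝ
  one_le_A : 1 ≤ A
  A_le_S : A ≤ S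
  A_le_Q : A ≤ Q
  α_pos : 0 < α
  α_lt_one : α < 1
  P_zero : P 0 = 0
  P_strictMono : ∀ s, s + 1 ≤ S → P s < P (s + 1)
  P_convex : ∀ s, s + 2 ≤ S → P (s + 1) - P s ≤ P (s + 2) - P (s + 1)

namespace BufferModel

/-- Buffer states `0, …, Q`. -/
abbrev State (M : BufferModel) : Type := Fin (M.Q + 1)

/-- Actions: the number `0, …, S` of transmitted packets. -/
abbrev Action (M : BufferModel) : Type := Fin (M.S + 1)

/-- No underflow and no overflow: `0 ≤ q - s ≤ Q - A`. -/
def Allowed (M : BufferModel) (q : M.State) (s : M.Action) : Prop :=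
  (s : ℕ) ≤ (q : ℕ) ∧ (q : ℕ) + M.A ≤ M.Q + (s : ℕ)

/-- Transition probability `Pr{q[n+1] = j | q[n] = q, s[n] = s}`: it is `α` if `j = q - s + A`,
`1 - α` if `j = q - s`, and `0` otherwise. -/
noncomputable def trans (M : BufferModel) (q : M.State) (s : M.Action) (j : M.State) : ℝ :=
  if (j : ℕ) + (s : ℕ) = (q : ℕ) + M.A then M.α
  else if (j : ℕ) + (s : ℕ) = (q : ℕ) then 1 - M.α
  else 0

/-- A feasible (randomized, history-dependent) transmission policy. `rule h q s` is the conditional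
probability of transmitting `s` packets when the current state is `q` and the earlier states and
actions are listed, most recent first, in `h`; the length of `h` determines the timeslot. -/
structure Policy (M : BufferModel) where
  rule : List (M.State × M.Action) → M.State → M.Action → ℝ
  nonneg : ∀ h q s, 0 ≤ rule h q s
  sum_eq_one : ∀ h q, ∑ s, rule h q s = 1
  feasible : ∀ h q s, ¬ M.Allowed q s → rule h q s = 0

/-- A feasible stationary deterministic policy: it transmits `act q` packets in state `q`. -/
structure DetPolicy (M : BufferModel) where
  act : M.State → M.Action
  allowed : ∀ q, M.Allowed q (act q)

/-- A deterministic policy, as a policy. -/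
def DetPolicy.toPolicy {M : BufferModel} (F : M.DetPolicy) : M.Policy where
  rule := fun _ q s => if s = F.act q then 1 else 0
  nonneg := by
    intro h q s
    split_ifs
    · exact zero_le_one
    · exact le_refl 0
  sum_eq_one := by
    intro h q
    simp
  feasible := by
    intro h q s hs
    have hne : s ≠ F.act q := by
      rintro rfl
      exact hs (F.allowed q)
    simp [hne]

/-- Two deterministic policies take different actions in exactly one state. -/
def DetPolicy.DifferInOneState {M : BufferModel} (F F' : M.DetPolicy) : Prop :=
  ∃ q, F.act q ≠ F'.act q ∧ ∀ q', q' ≠ q → F.act q' = F'.act q'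

/-- The probability, under policy `γ` and initial state `q₀`, that the states and actions of the
first timeslots are those listed (most recent first) in the history and that the state after them
is the given one. -/
noncomputable def histProb (M : BufferModel) (γ : M.Policy) (q₀ : M.State) :
    List (M.State × M.Action) → M.State → ℝ
  | [], q => if q = q₀ then 1 else 0
  | (q', s') :: h, q => histProb M γ q₀ h q' * γ.rule h q' s' * M.trans q' s' q

/-- The expectation `E_{q₀}^γ {c(q[k+1], s[k+1])}` of an immediate cost in the timeslot that is
preceded by `k` timeslots. -/
noncomputable def stageMean (M : BufferModel) (γ : M.Policy) (q₀ : M.State)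
    (c : M.State → M.Action → ℝ) (k : ℕ) : ℝ :=
  ∑ h : List.Vector (M.State × M.Action) k, ∑ q : M.State, ∑ s : M.Action,
    M.histProb γ q₀ h.toList q * γ.rule h.toList q s * c q s

/-- The expected time average `(1/N) E_{q₀}^γ {∑_{n=1}^N c(q[n], s[n])}`. -/
noncomputable def timeAverage (M : BufferModel) (γ : M.Policy) (q₀ : M.State)
    (c : M.State → M.Action → ℝ) (N : ℕ) : ℝ :=
  (1 / (N : ℝ)) * ∑ k ∈ Finset.range N, M.stageMean γ q₀ c k

/-- Policy `γ`, started in `q₀`, obtains the point `z = (P_γ, D_γ)` of the delay-power plane: the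
long-run average power exists and is `z.1`; the long-run average queue length, divided by the
arrival rate `α A`, exists and is the average delay `z.2`. -/
def Obtains (M : BufferModel) (γ : M.Policy) (q₀ : M.State) (z : ℝ × ℝ) : Prop :=
  Tendsto (M.timeAverage γ q₀ (fun _ s => M.P (s : ℕ))) atTop (𝓝 z.1) ∧
  Tendsto (fun N => (1 / (M.α * (M.A : ℝ))) * M.timeAverage γ q₀ (fun q _ => ((q : ℕ) : ℝ)) N)
    atTop (𝓝 z.2)

/-- The set of all feasible points in the delay-power plane. -/
def region (M : BufferModel) (q₀ : M.State) : Set (ℝ × ℝ) :=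
  {z | ∃ γ : M.Policy, M.Obtains γ q₀ z}

/-- The optimal delay-power tradeoff curve: the feasible points `(P, D)` such that every feasible
`(P', D')` has `P' ≥ P` or `D' ≥ D`. -/
def tradeoffCurve (M : BufferModel) (q₀ : M.State) : Set (ℝ × ℝ) :=
  {z | z ∈ M.region q₀ ∧ ∀ z' ∈ M.region q₀, z.1 ≤ z'.1 ∨ z.2 ≤ z'.2}

end BufferModel

/-- The polygonal chain with successive vertices `z 0, …, z n` (a point if `n = 0`). -/
def polygonalChain {n : ℕ} (z : Fin (n + 1) → ℝ × ℝ) : Set (ℝ × ℝ) :=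
  Set.range z ∪ ⋃ i : Fin n, segment ℝ (z i.castSucc) (z i.succ)

/-- The curve `C` in the plane is decreasing. -/
def DecreasingCurve (C : Set (ℝ × ℝ)) : Prop :=
  ∀ z ∈ C, ∀ w ∈ C, z.1 < w.1 → w.2 < z.2

/-- The curve `C` in the plane is convex: the set of points lying on or above it is convex. -/
def ConvexCurve (C : Set (ℝ × ℝ)) : Prop :=
  Convex ℝ {z : ℝ × ℝ | ∃ w ∈ C, w.1 = z.1 ∧ w.2 ≤ z.2}

/-- `v` is a corner of `C`: a point of `C` that is not in the interior of a nondegenerate line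
segment contained in `C`. -/
def IsCurveCorner (C : Set (ℝ × ℝ)) (v : ℝ × ℝ) : Prop :=
  v ∈ C ∧ ∀ a b : ℝ × ℝ, segment ℝ a b ⊆ C → v ∈ openSegment ℝ a b → a = b

/-! Describe a stationary policy by the level `x q` left in the buffer after transmission in state
`q`. For a multiplier `μ ≥ 0`, minimizing the average of power plus `μ` times delay leads to an
optimality equation, solved here as a limit of discounted problems (`exists_optimality_solution`).
Convexity of the power survives every Bellman step, so the relative value function is convex. Hence
the optimal levels in each state form an interval, and both ends of it grow by 0 or 1 from one state
to the next (`MonoLevels`). A policy of this shape has a state common to all its closed classes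
(`MonoLevels.exists_common_state`), so its averages do not depend on the initial state and its
Poisson equations are solvable; moreover, raising levels cannot lower the delay
(`MonoLevels.isGain_mono`).

Along an arbitrary policy the optimality equation telescopes, so its constant bounds power plus `μ`
times delay from below on the whole region: it gives a supporting line. On that line the lowest
optimal levels give the least delay and the highest ones the greatest, among points of monotone
policies (`OptimalitySolution.delay_bounds`). One climbs from the former to the latter by raising
one level by one at a time (`MonoLevels.exists_raise`), always through optimal levels; this produces
neighbouring vertices whose policies differ in one state.

The region is convex, by mixing policies, so a separation argument puts every point of the curve on
a supporting line. An infinite multiplier could be needed only at the least delay, and the linear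
bound `exists_power_delay_bound` replaces it by a finite one. Monotone policies give finitely many
points, so lowering `μ` from a large value meets finitely many faces (`exists_next_vertex`), and the
climbs on these faces join into a chain. A point on a supporting line is determined by its delay
(`OnFace.eq_of_delay_eq`); therefore the chain is the whole curve, for every initial state. -/

/-- `f` is convex on the integers `0, …, N`. -/
def ConvexUpTo (N : ℕ) (f : ℕ → ℝ) : Prop :=
  ∀ i, i + 2 ≤ N → f (i + 1) - f i ≤ f (i + 2) - f (i + 1)

theorem ConvexUpTo.slope_mono {N : ℕ} {f : ℕ → ℝ} (hf : ConvexUpTo N f) {a b : ℕ} (hab : a ≤ b)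
    (hb : b + 1 ≤ N) : f (a + 1) - f a ≤ f (b + 1) - f b := by
  induction b, hab using Nat.le_induction with
  | base => exact le_rfl
  | succ b hab ih => exact (ih (by omega)).trans (hf b hb)

/-! ### The one-stage problem with a convex terminal cost -/

namespace BufferModel

variable (M : BufferModel)

theorem power_convexUpTo : ConvexUpTo M.S M.P := M.P_convex

/-- `x` is an admissible number of packets left in the buffer after transmission in state `q`. -/
def AdmLevel (q x : ℕ) : Prop := x ≤ q ∧ q ≤ x + M.S ∧ x + M.A ≤ M.Q

/-- The admissible levels minimizing transmission power plus a terminal cost `w`. -/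
def optLevels (w : ℕ → ℝ) (q : ℕ) : Set ℕ :=
  {x | M.AdmLevel q x ∧ ∀ y, M.AdmLevel q y → M.P (q - x) + w x ≤ M.P (q - y) + w y}

variable {M}

theorem optLevels_nonempty (w : ℕ → ℝ) {q : ℕ} (hq : q ≤ M.Q) : (M.optLevels w q).Nonempty := by
  classical
  have hne : ((Finset.range (M.Q + 1)).filter (M.AdmLevel q)).Nonempty := by
    refine ⟨q - M.S, ?_⟩
    have := M.A_le_S
    have := M.A_le_Q
    simp only [Finset.mem_filter, Finset.mem_range, AdmLevel]
    omega
  obtain ⟨x, hx, hmin⟩ := Finset.exists_min_image _ (fun x => M.P (q - x) + w x) hne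
  refine ⟨x, (Finset.mem_filter.1 hx).2, fun y hy => hmin y ?_⟩
  have := hy.2.2
  simp only [Finset.mem_filter, Finset.mem_range]
  exact ⟨by omega, hy⟩

/-- Exchange argument: swapping the two residual levels between the states does not raise the total
cost, by convexity of the power, so both swapped choices are optimal too. -/
theorem mem_optLevels_of_lt {w : ℕ → ℝ} {q a b : ℕ} (ha : a ∈ M.optLevels w q)
    (hb : b ∈ M.optLevels w (q + 1)) (hab : b < a) :
    b ∈ M.optLevels w q ∧ a ∈ M.optLevels w (q + 1) := by
  obtain ⟨⟨a1, a2, a3⟩, a4⟩ := ha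
  obtain ⟨⟨b1, b2, b3⟩, b4⟩ := hb
  have hA : M.AdmLevel q b := ⟨by omega, by omega, b3⟩
  have hB : M.AdmLevel (q + 1) a := ⟨by omega, by omega, a3⟩
  have h := M.power_convexUpTo.slope_mono (a := q - a) (b := q - b) (by omega) (by omega)
  rw [show q - a + 1 = q + 1 - a by omega, show q - b + 1 = q + 1 - b by omega] at h
  have h1 := a4 b hA
  have h2 := b4 a hB
  exact ⟨⟨hA, fun y hy => by linarith [a4 y hy]⟩, ⟨hB, fun y hy => by linarith [b4 y hy]⟩⟩

/-- The dual exchange: here the numbers of transmitted packets are swapped, and convexity of `w` is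
what pays. -/
theorem mem_optLevels_of_succ_lt {w : ℕ → ℝ} (hw : ConvexUpTo (M.Q - M.A) w) {q a b : ℕ}
    (ha : a ∈ M.optLevels w q) (hb : b + 1 ∈ M.optLevels w (q + 1)) (hab : a < b) :
    b ∈ M.optLevels w q ∧ a + 1 ∈ M.optLevels w (q + 1) := by
  obtain ⟨⟨a1, a2, a3⟩, a4⟩ := ha
  obtain ⟨⟨b1, b2, b3⟩, b4⟩ := hb
  have hA : M.AdmLevel q b := ⟨by omega, by omega, by omega⟩
  have hB : M.AdmLevel (q + 1) (a + 1) := ⟨by omega, by omega, by omega⟩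
  have h := hw.slope_mono (a := a) (b := b) (by omega) (by omega)
  have h1 := a4 b hA
  have h2 := b4 (a + 1) hB
  simp only [Nat.add_sub_add_right] at b4 h2
  refine ⟨⟨hA, fun y hy => by linarith [a4 y hy]⟩, ⟨hB, fun y hy => ?_⟩⟩
  have := b4 y hy
  simp only [Nat.add_sub_add_right]
  linarith

/-- The objective is convex in the level, so its minimizers form an interval. The induction moves
the lower end up by one while comparing with the upper end moved down by one. -/
theorem mem_optLevels_of_between {w : ℕ → ℝ} (hw : ConvexUpTo (M.Q - M.A) w) {q a b x : ℕ}
    (ha : a ∈ M.optLevels w q) (hb : b ∈ M.optLevels w q) (hax : a ≤ x) (hxb : x ≤ b) :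
    x ∈ M.optLevels w q := by
  induction x, hax using Nat.le_induction with
  | base => exact ha
  | succ a _ ih =>
    obtain ⟨⟨a1, a2, a3⟩, a4⟩ := ih (by omega)
    obtain rfl | hlt := hxb.eq_or_lt
    · exact hb
    obtain ⟨c, rfl⟩ : ∃ c, b = c + 1 := ⟨b - 1, by omega⟩
    obtain ⟨⟨b1, b2, b3⟩, b4⟩ := hb
    have hA : M.AdmLevel q c := ⟨by omega, by omega, by omega⟩
    have hB : M.AdmLevel q (a + 1) := ⟨by omega, by omega, by omega⟩
    have h := hw.slope_mono (a := a) (b := c) (by omega) (by omega)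
    have h' := M.power_convexUpTo.slope_mono (a := q - (c + 1)) (b := q - (a + 1)) (by omega)
      (by omega)
    rw [show q - (c + 1) + 1 = q - c by omega, show q - (a + 1) + 1 = q - a by omega] at h'
    have h1 := a4 c hA
    exact ⟨hB, fun y hy => by linarith [b4 y hy]⟩

/-- The least optimal level. -/
noncomputable def loLevel (M : BufferModel) (w : ℕ → ℝ) (q : ℕ) : ℕ := sInf (M.optLevels w q)

/-- The greatest optimal level. -/
noncomputable def hiLevel (M : BufferModel) (w : ℕ → ℝ) (q : ℕ) : ℕ := sSup (M.optLevels w q)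

theorem optLevels_bddAbove (w : ℕ → ℝ) (q : ℕ) : BddAbove (M.optLevels w q) :=
  ⟨q, fun _ hx => hx.1.1⟩

theorem loLevel_mem (w : ℕ → ℝ) {q : ℕ} (hq : q ≤ M.Q) : M.loLevel w q ∈ M.optLevels w q :=
  Nat.sInf_mem (optLevels_nonempty w hq)

theorem hiLevel_mem (w : ℕ → ℝ) {q : ℕ} (hq : q ≤ M.Q) : M.hiLevel w q ∈ M.optLevels w q :=
  Nat.sSup_mem (optLevels_nonempty w hq) (optLevels_bddAbove w q)

theorem loLevel_le {w : ℕ → ℝ} {q x : ℕ} (hx : x ∈ M.optLevels w q) : M.loLevel w q ≤ x :=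
  Nat.sInf_le hx

theorem le_hiLevel {w : ℕ → ℝ} {q x : ℕ} (hx : x ∈ M.optLevels w q) : x ≤ M.hiLevel w q :=
  le_csSup (optLevels_bddAbove w q) hx

variable (M) in
/-- Admissible residual levels for all states, such that both the residual level and the number of
transmitted packets are nondecreasing in the state. -/
structure MonoLevels (x : ℕ → ℕ) : Prop where
  adm : ∀ q ≤ M.Q, M.AdmLevel q (x q)
  le_succ : ∀ q, q + 1 ≤ M.Q → x q ≤ x (q + 1)
  succ_le : ∀ q, q + 1 ≤ M.Q → x (q + 1) ≤ x q + 1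

/-- If a slope left `{0, 1}`, one of the two exchanges would produce an optimal level below the
least one. -/
theorem monoLevels_lo {w : ℕ → ℝ} (hw : ConvexUpTo (M.Q - M.A) w) :
    M.MonoLevels (M.loLevel w) where
  adm q hq := (loLevel_mem w hq).1
  le_succ q hq := by
    by_contra! h
    have := loLevel_le (mem_optLevels_of_lt (loLevel_mem w (by omega)) (loLevel_mem w hq) h).1
    omega
  succ_le q hq := by
    by_contra! h
    obtain ⟨b, hb⟩ : ∃ b, M.loLevel w (q + 1) = b + 1 := ⟨M.loLevel w (q + 1) - 1, by omega⟩
    have := loLevel_le (mem_optLevels_of_succ_lt hw (loLevel_mem w (by omega))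
      (hb ▸ loLevel_mem w hq) (by omega)).2
    omega

theorem monoLevels_hi {w : ℕ → ℝ} (hw : ConvexUpTo (M.Q - M.A) w) :
    M.MonoLevels (M.hiLevel w) where
  adm q hq := (hiLevel_mem w hq).1
  le_succ q hq := by
    by_contra! h
    have := le_hiLevel (mem_optLevels_of_lt (hiLevel_mem w (by omega)) (hiLevel_mem w hq) h).2
    omega
  succ_le q hq := by
    by_contra! h
    obtain ⟨b, hb⟩ : ∃ b, M.hiLevel w (q + 1) = b + 1 := ⟨M.hiLevel w (q + 1) - 1, by omega⟩
    have := le_hiLevel (mem_optLevels_of_succ_lt hw (hiLevel_mem w (by omega))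
      (hb ▸ hiLevel_mem w hq) (by omega)).1
    omega

variable (M) in
/-- The minimum of transmission power plus terminal cost. -/
noncomputable def minCost (w : ℕ → ℝ) (q : ℕ) : ℝ := M.P (q - M.loLevel w q) + w (M.loLevel w q)

theorem minCost_le {w : ℕ → ℝ} {q x : ℕ} (hx : M.AdmLevel q x) (hq : q ≤ M.Q) :
    M.minCost w q ≤ M.P (q - x) + w x := (loLevel_mem w hq).2 x hx

theorem minCost_eq {w : ℕ → ℝ} {q x : ℕ} (hx : x ∈ M.optLevels w q) (hq : q ≤ M.Q) :
    M.minCost w q = M.P (q - x) + w x :=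
  le_antisymm (minCost_le hx.1 hq) (hx.2 _ (loLevel_mem w hq).1)

/-- An infimal convolution of convex functions is convex: optimal choices at `q` and `q + 2` are
turned into two admissible choices at `q + 1` of no greater total cost. -/
theorem convexUpTo_minCost {w : ℕ → ℝ} (hw : ConvexUpTo (M.Q - M.A) w) :
    ConvexUpTo M.Q (M.minCost w) := by
  intro q hq
  obtain ⟨a1, a2, a3⟩ := (loLevel_mem (M := M) w (q := q) (by omega)).1
  obtain ⟨b1, b2, b3⟩ := (loLevel_mem (M := M) w hq).1
  have ea : M.minCost w q = M.P (q - M.loLevel w q) + w (M.loLevel w q) := rfl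
  have eb : M.minCost w (q + 2) =
    M.P (q + 2 - M.loLevel w (q + 2)) + w (M.loLevel w (q + 2)) := rfl
  set a := M.loLevel w q
  set b := M.loLevel w (q + 2)
  rw [ea, eb]
  clear_value a b
  -- For `b ≤ a` the levels are kept and convexity of the power is used; for `b = a + 1` keeping the
  -- levels just swaps the transmissions; for `b > a + 1` the transmissions are kept and convexity
  -- of `w` is used.
  rcases lt_trichotomy b (a + 1) with h | h | h
  · have h1 := minCost_le (M := M) (w := w) (q := q + 1) (x := a) ⟨by omega, by omega, a3⟩ (by omega)
    have h2 := minCost_le (M := M) (w := w) (q := q + 1) (x := b) ⟨by omega, by omega, b3⟩ (by omega)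
    have h' := M.power_convexUpTo.slope_mono (a := q - a) (b := q + 1 - b) (by omega) (by omega)
    rw [show q - a + 1 = q + 1 - a by omega, show q + 1 - b + 1 = q + 2 - b by omega] at h'
    linarith
  · have h1 := minCost_le (M := M) (w := w) (q := q + 1) (x := a) ⟨by omega, by omega, a3⟩ (by omega)
    have h2 := minCost_le (M := M) (w := w) (q := q + 1) (x := b) ⟨by omega, by omega, b3⟩ (by omega)
    rw [show q + 1 - a = q + 2 - b by omega] at h1
    rw [show q + 1 - b = q - a by omega] at h2
    linarith
  · obtain ⟨c, rfl⟩ : ∃ c, b = c + 1 := ⟨b - 1, by omega⟩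
    have h1 := minCost_le (M := M) (w := w) (q := q + 1) (x := a + 1)
      ⟨by omega, by omega, by omega⟩ (by omega)
    have h2 := minCost_le (M := M) (w := w) (q := q + 1) (x := c)
      ⟨by omega, by omega, by omega⟩ (by omega)
    have h' := hw.slope_mono (a := a) (b := c) (by omega) (by omega)
    rw [show q + 1 - (a + 1) = q - a by omega] at h1
    rw [show q + 1 - c = q + 2 - (c + 1) by omega] at h2
    linarith

variable (M) in
/-- The expectation of `h` at the next state when `x` packets are left after transmission. -/
def nextMean (h : ℕ → ℝ) (x : ℕ) : ℝ := (1 - M.α) * h x + M.α * h (x + M.A)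

theorem convexUpTo_nextMean {h : ℕ → ℝ} (hh : ConvexUpTo M.Q h) :
    ConvexUpTo (M.Q - M.A) (M.nextMean h) := by
  intro i hi
  have h1 := hh i (by omega)
  have h2 := hh (i + M.A) (by omega)
  rw [show i + M.A + 1 = i + 1 + M.A by omega, show i + M.A + 2 = i + 2 + M.A by omega] at h2
  have h3 := mul_le_mul_of_nonneg_left h1 (sub_nonneg.2 M.α_lt_one.le)
  have h4 := mul_le_mul_of_nonneg_left h2 M.α_pos.le
  unfold nextMean
  linarith

end BufferModel

/-! ### Expected time averages and the drift identity -/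

theorem sum_listVector_succ {β : Type*} [Fintype β] (k : ℕ) (f : List.Vector β (k + 1) → ℝ) :
    ∑ v, f v = ∑ p : β, ∑ v : List.Vector β k, f (p ::ᵥ v) := by
  rw [← Fintype.sum_prod_type']
  refine (Fintype.sum_equiv
    (⟨fun p => p.1 ::ᵥ p.2, fun v => (v.head, v.tail), fun p => by simp, fun v => by simp⟩ :
      β × List.Vector β k ≃ List.Vector β (k + 1)) _ _ fun p => rfl).symm

namespace BufferModel

variable {M : BufferModel}

theorem Allowed.admLevel {q : M.State} {s : M.Action} (h : M.Allowed q s) :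
    M.AdmLevel q ((q : ℕ) - (s : ℕ)) := by
  have := s.is_lt
  obtain ⟨h1, h2⟩ := h
  refine ⟨?_, ?_, ?_⟩ <;> omega

theorem trans_nonneg (q : M.State) (s : M.Action) (j : M.State) : 0 ≤ M.trans q s j := by
  unfold trans
  split_ifs
  · exact M.α_pos.le
  · exact sub_nonneg.2 M.α_lt_one.le
  · exact le_rfl

theorem sum_trans_mul {q : M.State} {s : M.Action} (h : M.Allowed q s) (f : ℕ → ℝ) :
    ∑ j : M.State, M.trans q s j * f j = M.nextMean f ((q : ℕ) - (s : ℕ)) := by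
  obtain ⟨h1, h2, h3⟩ := h.admLevel
  have hA := M.one_le_A
  have hq := q.is_lt
  have hs := h.1
  have h4 : (q : ℕ) - (s : ℕ) + M.A < M.Q + 1 := by omega
  have h5 : (q : ℕ) - (s : ℕ) < M.Q + 1 := by omega
  have key : ∀ j : M.State, M.trans q s j * f j =
      (if j = ⟨(q : ℕ) - (s : ℕ), h5⟩ then (1 - M.α) * f ((q : ℕ) - (s : ℕ)) else 0) +
      (if j = ⟨(q : ℕ) - (s : ℕ) + M.A, h4⟩ then M.α * f ((q : ℕ) - (s : ℕ) + M.A) else 0) := by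
    intro j
    unfold trans
    simp only [Fin.ext_iff]
    by_cases hj : (j : ℕ) + (s : ℕ) = (q : ℕ) + M.A
    · rw [if_pos hj, if_neg (by omega), if_pos (by omega), zero_add]
      congr 2
      omega
    · rw [if_neg hj]
      by_cases hj' : (j : ℕ) + (s : ℕ) = (q : ℕ)
      · rw [if_pos hj', if_pos (by omega), if_neg (by omega), add_zero]
        congr 2
        omega
      · rw [if_neg hj', if_neg (by omega), if_neg (by omega)]
        simp
  simp_rw [key, Finset.sum_add_distrib]
  simp [nextMean]

theorem histProb_nonneg (γ : M.Policy) (q₀ : M.State) :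
    ∀ h q, 0 ≤ M.histProb γ q₀ h q
  | [], q => by
    unfold histProb
    split_ifs
    · exact zero_le_one
    · exact le_rfl
  | (q', s') :: h, q => mul_nonneg
      (mul_nonneg (histProb_nonneg γ q₀ h q') (γ.nonneg h q' s')) (trans_nonneg q' s' q)

theorem stageMean_mono (γ : M.Policy) (q₀ : M.State) {c c' : M.State → M.Action → ℝ} (k : ℕ)
    (h : ∀ q s, M.Allowed q s → c q s ≤ c' q s) :
    M.stageMean γ q₀ c k ≤ M.stageMean γ q₀ c' k := by
  unfold stageMean
  refine Finset.sum_le_sum fun v _ => Finset.sum_le_sum fun q _ => Finset.sum_le_sum fun s _ => ?_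
  by_cases hs : M.Allowed q s
  · exact mul_le_mul_of_nonneg_left (h q s hs)
      (mul_nonneg (histProb_nonneg γ q₀ _ q) (γ.nonneg _ q s))
  · simp [γ.feasible _ q s hs]

theorem stageMean_congr (γ : M.Policy) (q₀ : M.State) {c c' : M.State → M.Action → ℝ} (k : ℕ)
    (h : ∀ q s, M.Allowed q s → c q s = c' q s) :
    M.stageMean γ q₀ c k = M.stageMean γ q₀ c' k :=
  le_antisymm (stageMean_mono γ q₀ k fun q s hs => (h q s hs).le)
    (stageMean_mono γ q₀ k fun q s hs => (h q s hs).ge)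

theorem stageMean_add (γ : M.Policy) (q₀ : M.State) (c c' : M.State → M.Action → ℝ) (k : ℕ) :
    M.stageMean γ q₀ (fun q s => c q s + c' q s) k =
      M.stageMean γ q₀ c k + M.stageMean γ q₀ c' k := by
  unfold stageMean
  simp only [mul_add, Finset.sum_add_distrib]

theorem stageMean_const_mul (γ : M.Policy) (q₀ : M.State) (a : ℝ) (c : M.State → M.Action → ℝ)
    (k : ℕ) : M.stageMean γ q₀ (fun q s => a * c q s) k = a * M.stageMean γ q₀ c k := by
  unfold stageMean
  simp only [Finset.mul_sum]
  refine Finset.sum_congr rfl fun v _ => Finset.sum_congr rfl fun q _ =>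
    Finset.sum_congr rfl fun s _ => by ring

/-- The Markov property: condition on the history before the last transition. It holds for
history-dependent policies, since the transition depends only on the current state and action. -/
theorem stageMean_state_succ (γ : M.Policy) (q₀ : M.State) (f : ℕ → ℝ) (k : ℕ) :
    M.stageMean γ q₀ (fun q _ => f q) (k + 1) =
      M.stageMean γ q₀ (fun q s => M.nextMean f ((q : ℕ) - (s : ℕ))) k := by
  rw [← stageMean_congr γ q₀ (c := fun q s => ∑ j : M.State, M.trans q s j * f j) k
    fun q s hs => sum_trans_mul hs f]
  unfold stageMean
  rw [sum_listVector_succ, Fintype.sum_prod_type]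
  have h1 : ∀ (h : List (M.State × M.Action)) (q : M.State),
      ∑ s, M.histProb γ q₀ h q * γ.rule h q s * f q = M.histProb γ q₀ h q * f q := by
    intro h q
    rw [← Finset.sum_mul, ← Finset.mul_sum, γ.sum_eq_one, mul_one]
  simp only [h1]
  simp only [List.Vector.toList_cons, histProb]
  rw [Finset.sum_comm' (t' := Finset.univ) (s' := fun _ => Finset.univ) (by simp)]
  simp_rw [Finset.sum_comm (s := (Finset.univ : Finset M.State))
    (t := (Finset.univ : Finset (List.Vector (M.State × M.Action) k)))]
  rw [Finset.sum_comm]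
  refine Finset.sum_congr rfl fun v _ => ?_
  rw [Finset.sum_comm]
  refine Finset.sum_congr rfl fun q _ => Finset.sum_congr rfl fun s _ => ?_
  rw [Finset.mul_sum]
  refine Finset.sum_congr rfl fun j _ => by ring

theorem stageMean_const (γ : M.Policy) (q₀ : M.State) (a : ℝ) (k : ℕ) :
    M.stageMean γ q₀ (fun _ _ => a) k = a := by
  induction k with
  | zero =>
    unfold stageMean
    have h1 : ∀ (h : List (M.State × M.Action)) (q : M.State),
        ∑ s, M.histProb γ q₀ h q * γ.rule h q s * a = M.histProb γ q₀ h q * a := by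
      intro h q
      rw [← Finset.sum_mul, ← Finset.mul_sum, γ.sum_eq_one, mul_one]
    simp only [h1]
    simp [histProb]
  | succ k ih =>
    rw [stageMean_state_succ γ q₀ (fun _ => a)]
    rw [← ih]
    refine stageMean_congr γ q₀ k fun q s _ => ?_
    simp only [nextMean]
    rw [ih]
    ring

theorem abs_stageMean_state_le (γ : M.Policy) (q₀ : M.State) (f : ℕ → ℝ) {C : ℝ}
    (hC : ∀ n ≤ M.Q, |f n| ≤ C) (k : ℕ) : |M.stageMean γ q₀ (fun q _ => f q) k| ≤ C := by
  rw [abs_le]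
  constructor
  · rw [← stageMean_const γ q₀ (-C) k]
    exact stageMean_mono γ q₀ k fun q s _ => (abs_le.1 (hC q (by omega))).1
  · rw [← stageMean_const γ q₀ C k]
    exact stageMean_mono γ q₀ k fun q s _ => (abs_le.1 (hC q (by omega))).2

theorem exists_abs_le (f : ℕ → ℝ) (N : ℕ) : ∃ C, ∀ n ≤ N, |f n| ≤ C :=
  ⟨∑ n ∈ Finset.range (N + 1), |f n|, fun n hn =>
    Finset.single_le_sum (f := fun n => |f n|) (fun i _ => abs_nonneg _)
      (Finset.mem_range.2 (by omega))⟩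

theorem timeAverage_mono (γ : M.Policy) (q₀ : M.State) {c c' : M.State → M.Action → ℝ} (N : ℕ)
    (h : ∀ q s, M.Allowed q s → c q s ≤ c' q s) :
    M.timeAverage γ q₀ c N ≤ M.timeAverage γ q₀ c' N :=
  mul_le_mul_of_nonneg_left (Finset.sum_le_sum fun k _ => stageMean_mono γ q₀ k h)
    (by positivity)

theorem timeAverage_add (γ : M.Policy) (q₀ : M.State) (c c' : M.State → M.Action → ℝ) (N : ℕ) :
    M.timeAverage γ q₀ (fun q s => c q s + c' q s) N =
      M.timeAverage γ q₀ c N + M.timeAverage γ q₀ c' N := by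
  unfold timeAverage
  simp only [stageMean_add, Finset.sum_add_distrib, mul_add]

theorem timeAverage_const_mul (γ : M.Policy) (q₀ : M.State) (a : ℝ)
    (c : M.State → M.Action → ℝ) (N : ℕ) :
    M.timeAverage γ q₀ (fun q s => a * c q s) N = a * M.timeAverage γ q₀ c N := by
  unfold timeAverage
  simp only [stageMean_const_mul, ← Finset.mul_sum]
  ring

theorem timeAverage_const (γ : M.Policy) (q₀ : M.State) (a : ℝ) {N : ℕ} (hN : N ≠ 0) :
    M.timeAverage γ q₀ (fun _ _ => a) N = a := by
  unfold timeAverage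
  simp only [stageMean_const, Finset.sum_const, Finset.card_range, nsmul_eq_mul]
  field_simp

theorem tendsto_div_natCast_of_bounded {u : ℕ → ℝ} {C : ℝ} (hu : ∀ n, |u n| ≤ C) :
    Tendsto (fun N : ℕ => (1 / (N : ℝ)) * u N) atTop (𝓝 0) := by
  have h : Tendsto (fun N : ℕ => (1 / (N : ℝ)) * C) atTop (𝓝 0) := by
    simpa using (tendsto_one_div_atTop_nhds_zero_nat (𝕜 := ℝ)).mul_const C
  refine squeeze_zero_norm (fun N => ?_) h
  rw [Real.norm_eq_abs, abs_mul, abs_of_nonneg (by positivity : (0 : ℝ) ≤ 1 / (N : ℝ))]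
  exact mul_le_mul_of_nonneg_left (hu N) (by positivity)

/-- The expected drifts telescope to a difference of two bounded terms, which dividing by `N` sends
to zero. -/
theorem tendsto_timeAverage_drift (γ : M.Policy) (q₀ : M.State) (f : ℕ → ℝ) :
    Tendsto (M.timeAverage γ q₀ fun q s => f q - M.nextMean f ((q : ℕ) - (s : ℕ))) atTop (𝓝 0) := by
  obtain ⟨C, hC⟩ := exists_abs_le f M.Q
  have h : ∀ N, ∑ k ∈ Finset.range N,
      M.stageMean γ q₀ (fun q s => f q - M.nextMean f ((q : ℕ) - (s : ℕ))) k =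
      M.stageMean γ q₀ (fun q _ => f q) 0 - M.stageMean γ q₀ (fun q _ => f q) N := by
    intro N
    rw [← Finset.sum_range_sub']
    refine Finset.sum_congr rfl fun k _ => ?_
    rw [stageMean_state_succ]
    have := stageMean_add γ q₀ (fun q s => f q - M.nextMean f ((q : ℕ) - (s : ℕ)))
      (fun q s => M.nextMean f ((q : ℕ) - (s : ℕ))) k
    simp only [sub_add_cancel] at this
    linarith
  refine tendsto_div_natCast_of_bounded (C := C + C) fun N => ?_
  rw [h]
  exact (abs_sub _ _).trans (add_le_add (abs_stageMean_state_le γ q₀ f hC 0)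
    (abs_stageMean_state_le γ q₀ f hC N))

theorem tendsto_timeAverage_const_add_drift (γ : M.Policy) (q₀ : M.State) (g : ℝ) (f : ℕ → ℝ) :
    Tendsto (M.timeAverage γ q₀ fun q s => g + (f q - M.nextMean f ((q : ℕ) - (s : ℕ)))) atTop
      (𝓝 g) := by
  have h := (tendsto_timeAverage_drift γ q₀ f).const_add g
  rw [add_zero] at h
  refine h.congr' ?_
  filter_upwards [eventually_ne_atTop 0] with N hN
  rw [timeAverage_add γ q₀ (fun _ _ => g), timeAverage_const γ q₀ g hN]

/-- The verification half of dynamic programming: a function `f` with this one-step inequality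
certifies a lower bound for every policy. -/
theorem le_of_tendsto_timeAverage {γ : M.Policy} {q₀ : M.State} {c : M.State → M.Action → ℝ}
    {g ℓ : ℝ} {f : ℕ → ℝ}
    (hc : ∀ q s, M.Allowed q s → g + (f q - M.nextMean f ((q : ℕ) - (s : ℕ))) ≤ c q s)
    (hℓ : Tendsto (M.timeAverage γ q₀ c) atTop (𝓝 ℓ)) : g ≤ ℓ :=
  le_of_tendsto_of_tendsto' (tendsto_timeAverage_const_add_drift γ q₀ g f) hℓ
    fun N => timeAverage_mono γ q₀ N hc

theorem DetPolicy.timeAverage_congr (F : M.DetPolicy) (q₀ : M.State)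
    {c c' : M.State → M.Action → ℝ} (h : ∀ q, c q (F.act q) = c' q (F.act q)) (N : ℕ) :
    M.timeAverage F.toPolicy q₀ c N = M.timeAverage F.toPolicy q₀ c' N := by
  unfold timeAverage stageMean
  congr 1
  refine Finset.sum_congr rfl fun k _ => Finset.sum_congr rfl fun v _ =>
    Finset.sum_congr rfl fun q _ => Finset.sum_congr rfl fun s _ => ?_
  by_cases hs : s = F.act q
  · rw [hs, h]
  · simp [DetPolicy.toPolicy, hs]

theorem DetPolicy.tendsto_timeAverage (F : M.DetPolicy) (q₀ : M.State)
    {c : M.State → M.Action → ℝ} {g : ℝ} {f : ℕ → ℝ}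
    (hc : ∀ q, c q (F.act q) =
      g + (f q - M.nextMean f ((q : ℕ) - (F.act q : ℕ)))) :
    Tendsto (M.timeAverage F.toPolicy q₀ c) atTop (𝓝 g) :=
  (tendsto_timeAverage_const_add_drift F.toPolicy q₀ g f).congr fun N =>
    (F.timeAverage_congr q₀ hc N).symm

end BufferModel

/-! ### Monotone policies: closed classes, Poisson equations and comparison of gains -/

namespace BufferModel

variable {M : BufferModel}

/-- The number of packets left after transmission, as a function of the state. -/
def DetPolicy.level (F : M.DetPolicy) (n : ℕ) : ℕ :=
  if h : n < M.Q + 1 then n - (F.act ⟨n, h⟩ : ℕ) else 0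

theorem DetPolicy.level_coe (F : M.DetPolicy) (q : M.State) :
    F.level q = (q : ℕ) - (F.act q : ℕ) := by
  exact dif_pos q.is_lt

/-- The deterministic policy leaving `x q` packets in state `q`. -/
def DetPolicy.ofLevels (x : ℕ → ℕ) (hx : ∀ q ≤ M.Q, M.AdmLevel q (x q)) : M.DetPolicy where
  act q := ⟨(q : ℕ) - x q, by
    have := (hx q (by omega)).2.1
    omega⟩
  allowed q := by
    obtain ⟨h1, h2, h3⟩ := hx q (by omega)
    exact ⟨Nat.sub_le _ _, by simp only; omega⟩

theorem DetPolicy.level_ofLevels {x : ℕ → ℕ} (hx : ∀ q ≤ M.Q, M.AdmLevel q (x q)) {n : ℕ}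
    (hn : n ≤ M.Q) : (DetPolicy.ofLevels x hx).level n = x n := by
  have := (hx n hn).1
  simp only [DetPolicy.level, DetPolicy.ofLevels, dif_pos (Nat.lt_succ_of_le hn)]
  omega

theorem MonoLevels.congr {x y : ℕ → ℕ} (hx : M.MonoLevels x) (h : ∀ n ≤ M.Q, y n = x n) :
    M.MonoLevels y where
  adm q hq := h q hq ▸ hx.adm q hq
  le_succ q hq := by
    rw [h q (by omega), h (q + 1) hq]
    exact hx.le_succ q hq
  succ_le q hq := by
    rw [h q (by omega), h (q + 1) hq]
    exact hx.succ_le q hq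

theorem MonoLevels.level_mono {x : ℕ → ℕ} (hx : M.MonoLevels x) {a b : ℕ} (hab : a ≤ b)
    (hb : b ≤ M.Q) : x a ≤ x b := by
  induction b, hab using Nat.le_induction with
  | base => exact le_rfl
  | succ b _ ih => exact (ih (by omega)).trans (hx.le_succ b hb)

theorem MonoLevels.level_le_add {x : ℕ → ℕ} (hx : M.MonoLevels x) {a b : ℕ} (hab : a ≤ b)
    (hb : b ≤ M.Q) : x b + a ≤ x a + b := by
  induction b, hab using Nat.le_induction with
  | base => exact le_rfl
  | succ b _ ih =>
    have := ih (by omega)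
    have := hx.succ_le b hb
    omega

variable (M) in
/-- `U` is a nonempty set of states that is closed under the transitions of the policy leaving
`x q` packets in state `q`. -/
structure ClosedClass (x : ℕ → ℕ) (U : Set ℕ) : Prop where
  nonempty : U.Nonempty
  le : ∀ n ∈ U, n ≤ M.Q
  level_mem : ∀ n ∈ U, x n ∈ U
  level_add_mem : ∀ n ∈ U, x n + M.A ∈ U

theorem ClosedClass.finite {x : ℕ → ℕ} {U : Set ℕ} (hU : M.ClosedClass x U) : U.Finite :=
  (Set.finite_Iic M.Q).subset hU.le

theorem MonoLevels.closedClass_Iic {x : ℕ → ℕ} (hx : M.MonoLevels x) :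
    M.ClosedClass x (Set.Iic M.Q) where
  nonempty := ⟨0, Nat.zero_le _⟩
  le _ hn := hn
  level_mem n hn := (hx.adm n hn).1.trans hn
  level_add_mem n hn := (hx.adm n hn).2.2

/-- The state is the largest fixed point `b` of `x`. A closed class reaches up to `b`, since a
maximum `m < b` would be a fixed level from which an arrival leads higher. The least member of the
class that is at least `b` cannot move down below `b`, so it is fixed, hence equals `b`. -/
theorem MonoLevels.exists_common_state {x : ℕ → ℕ} (hx : M.MonoLevels x) :
    ∃ b ≤ M.Q, ∀ U, M.ClosedClass x U → b ∈ U := by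
  have h0 : x 0 = 0 := Nat.le_zero.1 (hx.adm 0 (Nat.zero_le _)).1
  have hb : x (Nat.findGreatest (fun n => x n = n) M.Q) = Nat.findGreatest (fun n => x n = n) M.Q :=
    Nat.findGreatest_spec (P := fun n => x n = n) (Nat.zero_le _) h0
  have hbQ : Nat.findGreatest (fun n => x n = n) M.Q ≤ M.Q := Nat.findGreatest_le _
  have hmax : ∀ n ≤ M.Q, x n = n → n ≤ Nat.findGreatest (fun n => x n = n) M.Q :=
    fun n hn h => Nat.le_findGreatest hn h
  set b := Nat.findGreatest (fun n => x n = n) M.Q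
  refine ⟨b, hbQ, fun U hU => ?_⟩
  obtain ⟨m, hm, hmU⟩ := Set.exists_max_image U id hU.finite hU.nonempty
  have hA := M.one_le_A
  have h1 : b ≤ m := by
    by_contra! h
    have h2 := hx.level_le_add h.le hbQ
    have h3 : x m + M.A ≤ m := hmU _ (hU.level_add_mem m hm)
    omega
  obtain ⟨k, ⟨hkU, hkb⟩, hk⟩ := Set.exists_min_image (U ∩ Set.Ici b) id
    (hU.finite.subset Set.inter_subset_left) ⟨m, hm, h1⟩
  have hkb' : b ≤ k := hkb
  have h2 : b ≤ x k := hb ▸ hx.level_mono hkb' (hU.le k hkU)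
  have h3 : k ≤ x k := hk (x k) ⟨hU.level_mem k hkU, h2⟩
  have h4 := hmax k (hU.le k hkU) (le_antisymm (hx.adm k (hU.le k hkU)).1 h3)
  rwa [show b = k by omega]

theorem nextMean_le {f : ℕ → ℝ} {x : ℕ} {C : ℝ} (h1 : f x ≤ C) (h2 : f (x + M.A) ≤ C) :
    M.nextMean f x ≤ C := by
  have h3 := mul_le_mul_of_nonneg_left h1 (sub_nonneg.2 M.α_lt_one.le)
  have h4 := mul_le_mul_of_nonneg_left h2 M.α_pos.le
  unfold nextMean
  linarith

theorem nextMean_neg (f : ℕ → ℝ) (x : ℕ) : M.nextMean (fun n => -f n) x = -M.nextMean f x := by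
  unfold nextMean
  ring

theorem nextMean_sub (f f' : ℕ → ℝ) (x : ℕ) :
    M.nextMean (fun n => f n - f' n) x = M.nextMean f x - M.nextMean f' x := by
  unfold nextMean
  ring

/-- At a maximum of `f` on the class the drift term is nonnegative. -/
theorem ClosedClass.gain_le {x : ℕ → ℕ} {U : Set ℕ} (hU : M.ClosedClass x U) {c f : ℕ → ℝ}
    {g c₀ : ℝ} (h : ∀ n ∈ U, c n = g + (f n - M.nextMean f (x n))) (hc : ∀ n ∈ U, c n ≤ c₀) :
    g ≤ c₀ := by
  obtain ⟨m, hm, hmU⟩ := Set.exists_max_image U f hU.finite hU.nonempty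
  have h1 := nextMean_le (M := M) (hmU _ (hU.level_mem m hm)) (hmU _ (hU.level_add_mem m hm))
  have := h m hm
  have := hc m hm
  linarith

theorem ClosedClass.gain_eq_zero {x : ℕ → ℕ} {U : Set ℕ} (hU : M.ClosedClass x U) {f : ℕ → ℝ}
    {g : ℝ} (h : ∀ n ∈ U, 0 = g + (f n - M.nextMean f (x n))) : g = 0 := by
  refine le_antisymm (hU.gain_le (c := fun _ => 0) h fun _ _ => le_rfl) ?_
  have := hU.gain_le (c := fun _ => 0) (g := -g) (f := fun n => -f n)
    (fun n hn => by rw [nextMean_neg]; linarith [h n hn]) fun _ _ => le_rfl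
  linarith

variable (M) in
/-- `g` is the long-run average of the cost `c` (per state) under the policy leaving `x q` packets
in state `q`, as witnessed by a solution of the Poisson equation. -/
def IsGain (x : ℕ → ℕ) (c : ℕ → ℝ) (g : ℝ) : Prop :=
  ∃ f : ℕ → ℝ, ∀ n ≤ M.Q, c n = g + (f n - M.nextMean f (x n))

/-- The gain is already determined by what happens on one closed class, so two policies that agree
there have equal gains. `OptimalitySolution.delay_bounds` relies on this freedom elsewhere. -/
theorem ClosedClass.isGain_unique {x x' : ℕ → ℕ} {U : Set ℕ} (hU : M.ClosedClass x U)
    {c c' : ℕ → ℝ} {g g' : ℝ} (h : M.IsGain x c g) (h' : M.IsGain x' c' g')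
    (hx : ∀ n ∈ U, x' n = x n) (hc : ∀ n ∈ U, c' n = c n) : g = g' := by
  obtain ⟨f, hf⟩ := h
  obtain ⟨f', hf'⟩ := h'
  refine sub_eq_zero.1 (hU.gain_eq_zero (f := fun n => f n - f' n) fun n hn => ?_)
  have h1 := hf n (hU.le n hn)
  have h2 := hf' n (hU.le n hn)
  rw [hx n hn, hc n hn] at h2
  rw [nextMean_sub]
  linarith

theorem MonoLevels.isGain_unique {x : ℕ → ℕ} (hx : M.MonoLevels x) {c : ℕ → ℝ} {g g' : ℝ}
    (h : M.IsGain x c g) (h' : M.IsGain x c g') : g = g' :=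
  hx.closedClass_Iic.isGain_unique h h' (fun _ _ => rfl) fun _ _ => rfl

theorem IsGain.add_mul {x : ℕ → ℕ} {c c' : ℕ → ℝ} {g g' : ℝ} (h : M.IsGain x c g)
    (h' : M.IsGain x c' g') (a : ℝ) : M.IsGain x (fun n => c n + a * c' n) (g + a * g') := by
  obtain ⟨f, hf⟩ := h
  obtain ⟨f', hf'⟩ := h'
  refine ⟨fun n => f n + a * f' n, fun n hn => ?_⟩
  dsimp only
  rw [hf n hn, hf' n hn]
  unfold nextMean
  ring

theorem IsGain.congr {x y : ℕ → ℕ} {c c' : ℕ → ℝ} {g : ℝ} (h : M.IsGain x c g)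
    (hx : ∀ n ≤ M.Q, y n = x n) (hc : ∀ n ≤ M.Q, c' n = c n) : M.IsGain y c' g := by
  obtain ⟨f, hf⟩ := h
  exact ⟨f, fun n hn => by rw [hx n hn, hc n hn, hf n hn]⟩

/-- Strong maximum principle: arrival and non-arrival both have positive probability, so both
successors of a maximum must be maxima. -/
theorem closedClass_argmax {x : ℕ → ℕ} (hx : ∀ q ≤ M.Q, M.AdmLevel q (x q)) {f : ℕ → ℝ} {C : ℝ}
    (hf : ∀ n ≤ M.Q, f n ≤ M.nextMean f (x n)) (hC : ∀ n ≤ M.Q, f n ≤ C)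
    (hne : ∃ n ≤ M.Q, f n = C) : M.ClosedClass x {n | n ≤ M.Q ∧ f n = C} := by
  have key : ∀ n, n ≤ M.Q ∧ f n = C → f (x n) = C ∧ f (x n + M.A) = C := by
    rintro n ⟨hn, hfn⟩
    have h1 := hC (x n) ((hx n hn).1.trans hn)
    have h2 := hC (x n + M.A) (hx n hn).2.2
    have h3 := hf n hn
    have h4 := M.α_pos
    have h5 := sub_pos.2 M.α_lt_one
    rw [hfn, nextMean] at h3
    constructor
    · by_contra hne
      have h6 := mul_lt_mul_of_pos_left (lt_of_le_of_ne h1 hne) h5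
      have h7 := mul_le_mul_of_nonneg_left h2 h4.le
      linarith
    · by_contra hne
      have h6 := mul_lt_mul_of_pos_left (lt_of_le_of_ne h2 hne) h4
      have h7 := mul_le_mul_of_nonneg_left h1 h5.le
      linarith
  exact ⟨hne, fun n hn => hn.1, fun n hn => ⟨(hx n hn.1).1.trans hn.1, (key n hn).1⟩,
    fun n hn => ⟨(hx n hn.1).2.2, (key n hn).2⟩⟩

theorem le_of_subharmonic {x : ℕ → ℕ} (hx : ∀ q ≤ M.Q, M.AdmLevel q (x q)) {b : ℕ}
    (hb : ∀ U, M.ClosedClass x U → b ∈ U) {f : ℕ → ℝ}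
    (hf : ∀ n ≤ M.Q, f n ≤ M.nextMean f (x n)) {n : ℕ} (hn : n ≤ M.Q) : f n ≤ f b := by
  obtain ⟨m, hm, hmax⟩ := Set.exists_max_image (Set.Iic M.Q) f (Set.finite_Iic _) ⟨0, Nat.zero_le _⟩
  have h := hb _ (closedClass_argmax hx hf hmax ⟨m, hm, rfl⟩)
  rw [h.2]
  exact hmax n hn

/-- Normalize the unknown gain to be the value of `f` at the common state `b`. The resulting linear
operator `T` is square, so injectivity suffices. A kernel element has zero gain, hence is harmonic,
hence attains its maximum and minimum at `b`, where it vanishes. -/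
theorem MonoLevels.exists_isGain {x : ℕ → ℕ} (hx : M.MonoLevels x) (c : ℕ → ℝ) :
    ∃ g, M.IsGain x c g := by
  obtain ⟨b, hbQ, hb⟩ := hx.exists_common_state
  let ext : (M.State → ℝ) →ₗ[ℝ] (ℕ → ℝ) :=
    { toFun := fun f n => if h : n < M.Q + 1 then f ⟨n, h⟩ else 0
      map_add' := fun f f' => by
        ext n
        by_cases h : n < M.Q + 1
        · simp only [Pi.add_apply, dif_pos h]
        · simp only [Pi.add_apply, dif_neg h, add_zero]
      map_smul' := fun a f => by
        ext n
        by_cases h : n < M.Q + 1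
        · simp only [Pi.smul_apply, dif_pos h, RingHom.id_apply]
        · simp only [Pi.smul_apply, dif_neg h, RingHom.id_apply, smul_zero] }
  let T : (M.State → ℝ) →ₗ[ℝ] (M.State → ℝ) :=
    { toFun := fun f q => ext f b + (ext f q - M.nextMean (ext f) (x q))
      map_add' := fun f f' => by
        ext q
        simp only [map_add, Pi.add_apply, nextMean]
        ring
      map_smul' := fun a f => by
        ext q
        simp only [map_smul, Pi.smul_apply, nextMean, smul_eq_mul, RingHom.id_apply]
        ring }
  have hT : ∀ f q, T f q = ext f b + (ext f q - M.nextMean (ext f) (x q)) := fun _ _ => rfl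
  have hinj : Function.Injective T := by
    rw [injective_iff_map_eq_zero]
    intro f hf
    have h1 : ∀ n ≤ M.Q, 0 = ext f b + (ext f n - M.nextMean (ext f) (x n)) := fun n hn => by
      have := congrFun hf ⟨n, Nat.lt_succ_of_le hn⟩
      rw [hT] at this
      exact this.symm
    have h2 : ext f b = 0 := hx.closedClass_Iic.gain_eq_zero h1
    have h3 : ∀ n ≤ M.Q, ext f n ≤ 0 := fun n hn => h2 ▸
      le_of_subharmonic hx.adm hb (fun n hn => by linarith [h1 n hn]) hn
    have h4 : ∀ n ≤ M.Q, - ext f n ≤ - ext f b := fun n hn =>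
      le_of_subharmonic (f := fun n => - ext f n) hx.adm hb
        (fun n hn => by rw [nextMean_neg]; linarith [h1 n hn]) hn
    ext q
    have h5 : ext f q = f q := dif_pos q.is_lt
    have h6 := h3 q (by omega)
    have h7 := h4 q (by omega)
    rw [h5] at h6 h7
    rw [h2] at h7
    exact le_antisymm h6 (by simpa using h7)
  obtain ⟨f, hf⟩ := LinearMap.injective_iff_surjective.1 hinj fun q => c q
  refine ⟨ext f b, ext f, fun n hn => ?_⟩
  have := congrFun hf ⟨n, Nat.lt_succ_of_le hn⟩
  rw [hT] at this
  exact this.symm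

variable (M) in
/-- The conditional expectation of `f` after one step of the policy leaving `x q` packets in
state `q`. -/
def evolve (x : ℕ → ℕ) (f : ℕ → ℝ) (n : ℕ) : ℝ := M.nextMean f (x n)

theorem nextMean_mono {f f' : ℕ → ℝ} {x x' : ℕ} (h1 : f x ≤ f' x')
    (h2 : f (x + M.A) ≤ f' (x' + M.A)) : M.nextMean f x ≤ M.nextMean f' x' := by
  have h3 := mul_le_mul_of_nonneg_left h1 (sub_nonneg.2 M.α_lt_one.le)
  have h4 := mul_le_mul_of_nonneg_left h2 M.α_pos.le
  unfold nextMean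
  linarith

theorem MonoLevels.monotoneOn_evolve {x : ℕ → ℕ} (hx : M.MonoLevels x) {f : ℕ → ℝ}
    (hf : MonotoneOn f (Set.Iic M.Q)) : MonotoneOn (M.evolve x f) (Set.Iic M.Q) := by
  intro a ha b hb hab
  have h1 := hx.closedClass_Iic
  have h2 := hx.level_mono hab hb
  exact nextMean_mono (hf (h1.level_mem a ha) (h1.level_mem b hb) h2)
    (hf (h1.level_add_mem a ha) (h1.level_add_mem b hb) (by omega))

/-- Stochastic monotonicity. The two claims must be proved together: monotonicity for `x` lets its
starting point be raised to that of `x'`, after which the comparison applies. -/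
theorem MonoLevels.iterate_evolve_le {x x' : ℕ → ℕ} (hx : M.MonoLevels x) (hx' : M.MonoLevels x')
    (hxx' : ∀ n ≤ M.Q, x n ≤ x' n) {f : ℕ → ℝ} (hf : MonotoneOn f (Set.Iic M.Q)) (k : ℕ) :
    MonotoneOn ((M.evolve x)^[k] f) (Set.Iic M.Q) ∧
      ∀ n ≤ M.Q, (M.evolve x)^[k] f n ≤ (M.evolve x')^[k] f n := by
  induction k with
  | zero => exact ⟨hf, fun _ _ => le_rfl⟩
  | succ k ih =>
    simp only [Function.iterate_succ_apply']
    refine ⟨hx.monotoneOn_evolve ih.1, fun n hn => ?_⟩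
    have h1 := hx.closedClass_Iic
    have h2 := hx'.closedClass_Iic
    exact nextMean_mono
      ((ih.1 (h1.level_mem n hn) (h2.level_mem n hn) (hxx' n hn)).trans
        (ih.2 _ (h2.level_mem n hn)))
      ((ih.1 (h1.level_add_mem n hn) (h2.level_add_mem n hn) (by have := hxx' n hn; omega)).trans
        (ih.2 _ (h2.level_add_mem n hn)))

theorem MonoLevels.abs_iterate_evolve_le {x : ℕ → ℕ} (hx : M.MonoLevels x) {f : ℕ → ℝ} {C : ℝ}
    (hC : ∀ n ≤ M.Q, |f n| ≤ C) (k : ℕ) : ∀ n ≤ M.Q, |(M.evolve x)^[k] f n| ≤ C := by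
  induction k with
  | zero => exact hC
  | succ k ih =>
    intro n hn
    rw [Function.iterate_succ_apply']
    have h1 := abs_le.1 (ih _ (hx.closedClass_Iic.level_mem n hn))
    have h2 := abs_le.1 (ih _ (hx.closedClass_Iic.level_add_mem n hn))
    refine abs_le'.2 ⟨nextMean_le h1.2 h2.2, ?_⟩
    rw [evolve, ← nextMean_neg]
    exact nextMean_le (by linarith) (by linarith)

theorem MonoLevels.sum_iterate_evolve {x : ℕ → ℕ} (hx : M.MonoLevels x) {c f : ℕ → ℝ} {g : ℝ}
    (h : ∀ n ≤ M.Q, c n = g + (f n - M.nextMean f (x n))) (N : ℕ) :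
    ∀ n ≤ M.Q, ∑ k ∈ Finset.range N, (M.evolve x)^[k] c n =
      N * g + (f n - (M.evolve x)^[N] f n) := by
  have key : ∀ k, ∀ n ≤ M.Q, (M.evolve x)^[k] c n =
      g + ((M.evolve x)^[k] f n - (M.evolve x)^[k + 1] f n) := by
    intro k
    induction k with
    | zero => exact h
    | succ k ih =>
      intro n hn
      rw [Function.iterate_succ_apply', Function.iterate_succ_apply' _ (k + 1),
        Function.iterate_succ_apply' _ k, evolve, nextMean,
        ih _ (hx.closedClass_Iic.level_mem n hn), ih _ (hx.closedClass_Iic.level_add_mem n hn),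
        Function.iterate_succ_apply' _ k]
      conv_rhs => rw [evolve, nextMean, evolve, nextMean]
      ring
  intro n hn
  rw [Finset.sum_congr rfl fun k _ => key k n hn, Finset.sum_add_distrib, Finset.sum_range_sub']
  simp

theorem MonoLevels.isGain_mono {x x' : ℕ → ℕ} (hx : M.MonoLevels x) (hx' : M.MonoLevels x')
    (hxx' : ∀ n ≤ M.Q, x n ≤ x' n) {c : ℕ → ℝ} (hc : MonotoneOn c (Set.Iic M.Q)) {g g' : ℝ}
    (h : M.IsGain x c g) (h' : M.IsGain x' c g') : g ≤ g' := by
  obtain ⟨f, hf⟩ := h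
  obtain ⟨f', hf'⟩ := h'
  obtain ⟨C, hC⟩ := exists_abs_le f M.Q
  obtain ⟨C', hC'⟩ := exists_abs_le f' M.Q
  by_contra! hlt
  -- Sums of `N` stage costs equal `N` times the gain up to the four boundary terms, which
  -- contribute at most `2 * C + 2 * C'`; for this `N` the gap between the gains outweighs them.
  obtain ⟨N, hN⟩ := exists_nat_gt ((2 * C + 2 * C') / (g - g'))
  rw [div_lt_iff₀ (sub_pos.2 hlt)] at hN
  have h1 := hx.sum_iterate_evolve hf N 0 (Nat.zero_le _)
  have h2 := hx'.sum_iterate_evolve hf' N 0 (Nat.zero_le _)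
  have h3 := Finset.sum_le_sum fun k (_ : k ∈ Finset.range N) =>
    (hx.iterate_evolve_le hx' hxx' hc k).2 0 (Nat.zero_le _)
  have h4 := abs_le.1 (hC 0 (Nat.zero_le _))
  have h5 := abs_le.1 (hC' 0 (Nat.zero_le _))
  have h6 := abs_le.1 (hx.abs_iterate_evolve_le hC N 0 (Nat.zero_le _))
  have h7 := abs_le.1 (hx'.abs_iterate_evolve_le hC' N 0 (Nat.zero_le _))
  nlinarith

end BufferModel

/-! ### The optimality equation by vanishing discount -/

theorem ConvexUpTo.const_mul {N : ℕ} {f : ℕ → ℝ} (hf : ConvexUpTo N f) {a : ℝ} (ha : 0 ≤ a) :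
    ConvexUpTo N fun n => a * f n := fun i hi => by
  have := mul_le_mul_of_nonneg_left (hf i hi) ha
  dsimp only
  linarith

theorem ConvexUpTo.of_tendsto {N : ℕ} {f : ℕ → ℕ → ℝ} {f' : ℕ → ℝ}
    (hf : ∀ k, ConvexUpTo N (f k)) (h : ∀ n ≤ N, Tendsto (fun k => f k n) atTop (𝓝 (f' n))) :
    ConvexUpTo N f' := fun i hi =>
  le_of_tendsto_of_tendsto' ((h (i + 1) (by omega)).sub (h i (by omega)))
    ((h (i + 2) (by omega)).sub (h (i + 1) (by omega))) fun k => hf k i hi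

namespace BufferModel

variable {M : BufferModel}

instance : Finite M.DetPolicy :=
  Finite.of_injective DetPolicy.act fun F F' h => by
    cases F
    cases F'
    congr

variable (M) in
/-- A function of the state, as a function on `ℕ`. -/
def extend (v : M.State → ℝ) (n : ℕ) : ℝ := if h : n < M.Q + 1 then v ⟨n, h⟩ else 0

theorem extend_apply (v : M.State → ℝ) {n : ℕ} (hn : n ≤ M.Q) :
    M.extend v n = v ⟨n, Nat.lt_succ_of_le hn⟩ := dif_pos _

theorem abs_extend_sub_le (v v' : M.State → ℝ) {n : ℕ} (hn : n ≤ M.Q) :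
    |M.extend v n - M.extend v' n| ≤ dist v v' := by
  rw [extend_apply v hn, extend_apply v' hn, ← Real.dist_eq]
  exact dist_le_pi_dist v v' _

theorem minCost_le_add {w w' : ℕ → ℝ} {δ : ℝ} (h : ∀ x, x + M.A ≤ M.Q → w x ≤ w' x + δ) {q : ℕ}
    (hq : q ≤ M.Q) : M.minCost w q ≤ M.minCost w' q + δ := by
  have h1 := (loLevel_mem (M := M) w' hq).1
  have h2 := minCost_le (w := w) h1 hq
  have h3 := h _ h1.2.2
  unfold minCost at h2 ⊢
  linarith

variable (M) in
/-- The Bellman operator with discount factor `β` for the cost `ν` per waiting packet plus power. -/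
noncomputable def bellman (ν β : ℝ) (v : M.State → ℝ) (q : M.State) : ℝ :=
  ν * (q : ℕ) + M.minCost (fun x => β * M.nextMean (M.extend v) x) q

theorem bellman_le_add (ν : ℝ) {β : ℝ} (hβ : 0 ≤ β) (v v' : M.State → ℝ) (q : M.State) :
    M.bellman ν β v q ≤ M.bellman ν β v' q + β * dist v v' := by
  unfold bellman
  rw [add_assoc]
  refine add_le_add le_rfl (minCost_le_add (fun x hx => ?_) (by omega))
  rw [← mul_add]
  refine mul_le_mul_of_nonneg_left ?_ hβ
  have h1 := (abs_le.1 (abs_extend_sub_le v v' (n := x) (by omega))).2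
  have h2 := (abs_le.1 (abs_extend_sub_le v v' hx)).2
  have h3 := nextMean_le (M := M) (f := fun n => M.extend v n - M.extend v' n) h1 h2
  rw [nextMean_sub] at h3
  linarith

theorem contractingWith_bellman (ν : ℝ) {β : ℝ} (h0 : 0 ≤ β) (h1 : β < 1) :
    ContractingWith ⟨β, h0⟩ (M.bellman ν β) := by
  refine ⟨h1, LipschitzWith.of_dist_le_mul fun v v' => ?_⟩
  refine (dist_pi_le_iff (mul_nonneg h0 dist_nonneg)).2 fun q => ?_
  rw [Real.dist_eq, abs_le]
  have h2 := bellman_le_add ν h0 v v' q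
  have h3 := bellman_le_add ν h0 v' v q
  rw [dist_comm] at h3
  constructor
  · change -(β * dist v v') ≤ _
    linarith
  · change _ ≤ β * dist v v'
    linarith

theorem convexUpTo_bellman (ν : ℝ) {β : ℝ} (hβ : 0 ≤ β) {v : M.State → ℝ}
    (hv : ConvexUpTo M.Q (M.extend v)) : ConvexUpTo M.Q (M.extend (M.bellman ν β v)) := by
  intro i hi
  have h := convexUpTo_minCost ((convexUpTo_nextMean hv).const_mul hβ) i hi
  rw [extend_apply _ (by omega), extend_apply _ (by omega), extend_apply _ (by omega)]
  simp only [bellman]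
  push_cast
  linarith

/-- Value iteration from zero stays convex and converges to the fixed point of the contraction, so
convexity passes to the limit. -/
theorem exists_discounted_value (ν : ℝ) {β : ℝ} (h0 : 0 ≤ β) (h1 : β < 1) :
    ∃ V : ℕ → ℝ, ConvexUpTo M.Q V ∧
      ∀ n ≤ M.Q, V n = ν * n + M.minCost (fun x => β * M.nextMean V x) n := by
  have hc := contractingWith_bellman (M := M) ν h0 h1
  refine ⟨M.extend hc.fixedPoint, ?_, fun n hn => ?_⟩
  · have hconv : ∀ k, ConvexUpTo M.Q (M.extend ((M.bellman ν β)^[k] 0)) := by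
      intro k
      induction k with
      | zero =>
        intro i hi
        rw [extend_apply _ (by omega), extend_apply _ (by omega), extend_apply _ (by omega)]
        simp
      | succ k ih =>
        rw [Function.iterate_succ_apply']
        exact convexUpTo_bellman ν h0 ih
    refine ConvexUpTo.of_tendsto hconv fun n hn => ?_
    simp only [extend_apply _ hn]
    exact tendsto_pi_nhds.1 (hc.tendsto_iterate_fixedPoint 0) _
  · conv_lhs => rw [← hc.fixedPoint_isFixedPt]
    rw [extend_apply _ hn]
    rfl

/-- The bound must not depend on `β`. The error `V - g / (1 - β) - f` solves a discounted equation
with source of size at most `(1 - β) * C`, so it is bounded by `C`. -/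
theorem abs_discounted_sub_le {x : ℕ → ℕ} (hx : M.MonoLevels x) {c f V : ℕ → ℝ} {g β C : ℝ}
    (hf : ∀ n ≤ M.Q, c n = g + (f n - M.nextMean f (x n))) (h0 : 0 ≤ β) (h1 : β < 1)
    (hV : ∀ n ≤ M.Q, V n = c n + β * M.nextMean V (x n)) (hC : ∀ n ≤ M.Q, |f n| ≤ C) :
    ∀ n ≤ M.Q, |V n - g / (1 - β)| ≤ 2 * C := by
  have hβ : 0 < 1 - β := sub_pos.2 h1
  obtain ⟨m, hm, hmax⟩ := Set.exists_max_image (Set.Iic M.Q) (fun n => |V n - g / (1 - β) - f n|)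
    (Set.finite_Iic _) ⟨0, Nat.zero_le _⟩
  have hU : ∀ n ≤ M.Q, V n - g / (1 - β) - f n =
      β * M.nextMean (fun n => V n - g / (1 - β) - f n) (x n) +
        (1 - β) * M.nextMean (fun n => - f n) (x n) := by
    intro n hn
    rw [hV n hn, hf n hn]
    unfold nextMean
    field_simp
    ring
  have hcl := hx.closedClass_Iic
  have key : |V m - g / (1 - β) - f m| ≤ C := by
    have h2 := abs_le.1 (hmax _ (hcl.level_mem m hm))
    have h3 := abs_le.1 (hmax _ (hcl.level_add_mem m hm))
    have h4 := abs_le.1 (hC _ (hcl.level_mem m hm))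
    have h5 := abs_le.1 (hC _ (hcl.level_add_mem m hm))
    have e1 := nextMean_le (M := M) (f := fun n => V n - g / (1 - β) - f n) h2.2 h3.2
    have e2 := nextMean_le (M := M) (f := fun n => - (V n - g / (1 - β) - f n))
      (neg_le.1 h2.1) (neg_le.1 h3.1)
    have e3 := nextMean_le (M := M) (f := fun n => - f n) (neg_le.1 h4.1) (neg_le.1 h5.1)
    have e4 := nextMean_le (M := M) (f := f) h4.2 h5.2
    rw [nextMean_neg] at e2 e3
    have hUm := hU m hm
    rw [nextMean_neg f] at hUm
    have a1 := mul_le_mul_of_nonneg_left e1 h0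
    have a2 := mul_le_mul_of_nonneg_left e2 h0
    have a3 := mul_le_mul_of_nonneg_left e3 hβ.le
    have a4 := mul_le_mul_of_nonneg_left e4 hβ.le
    have h6 : |V m - g / (1 - β) - f m| ≤ β * |V m - g / (1 - β) - f m| + (1 - β) * C :=
      abs_le'.2 ⟨by linarith, by linarith⟩
    exact le_of_mul_le_mul_left (by linarith) hβ
  intro n hn
  have h2 := abs_le.1 ((hmax n hn).trans key)
  have h3 := abs_le.1 (hC n hn)
  exact abs_le.2 ⟨by linarith, by linarith⟩

/-- Pigeonhole: there are finitely many deterministic policies, so one is optimal for arbitrarily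
large `k`, that is, for discount factors tending to 1. -/
theorem exists_frequent_policy (ν : ℝ) : ∃ F : M.DetPolicy, M.MonoLevels F.level ∧
    ∃ᶠ k : ℕ in atTop, ∃ V : ℕ → ℝ, ConvexUpTo M.Q V ∧
      (∀ n ≤ M.Q, ∀ y, M.AdmLevel n y →
        V n ≤ ν * n + M.P (n - y) + (1 - 1 / ((k : ℝ) + 1)) * M.nextMean V y) ∧
      ∀ n ≤ M.Q, V n = ν * n + M.P (n - F.level n) +
        (1 - 1 / ((k : ℝ) + 1)) * M.nextMean V (F.level n) := by
  have h0 : ∀ k : ℕ, 0 ≤ 1 - 1 / ((k : ℝ) + 1) := fun k => by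
    rw [sub_nonneg, div_le_one (by positivity)]
    linarith [k.cast_nonneg (α := ℝ)]
  have h1 : ∀ k : ℕ, 1 - 1 / ((k : ℝ) + 1) < 1 := fun k => by
    have : 0 < 1 / ((k : ℝ) + 1) := by positivity
    linarith
  choose V hV hVeq using fun k => exists_discounted_value (M := M) ν (h0 k) (h1 k)
  have hw := fun k => (convexUpTo_nextMean (hV k)).const_mul (h0 k)
  have hmono := fun k => monoLevels_lo (hw k)
  let F : ℕ → M.DetPolicy := fun k => DetPolicy.ofLevels _ (hmono k).adm
  have hF : ∃ᶠ k in atTop, ∃ G, F k = G := Frequently.of_forall fun k => ⟨_, rfl⟩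
  obtain ⟨G, hG⟩ := frequently_exists.1 hF
  have hlevel : ∀ k, F k = G → ∀ n ≤ M.Q, G.level n =
      M.loLevel (fun x => (1 - 1 / ((k : ℝ) + 1)) * M.nextMean (V k) x) n := fun k hk n hn => by
    rw [← hk, DetPolicy.level_ofLevels _ hn]
  refine ⟨G, ?_, hG.mono fun k hk => ⟨V k, hV k, fun n hn y hy => ?_, fun n hn => ?_⟩⟩
  · obtain ⟨k, hk⟩ := hG.exists
    exact (hmono k).congr (hlevel k hk)
  · rw [hVeq k n hn, add_assoc]
    exact add_le_add le_rfl (minCost_le hy hn)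
  · rw [hVeq k n hn, add_assoc, hlevel k hk n hn]
    rfl

/-- With one policy fixed along a subsequence, the discounted values minus `g / (1 - β)` are
uniformly bounded; a further subsequence converges, and the discounted inequalities, equalities and
convexity pass to the limit. -/
theorem exists_optimality_solution (ν : ℝ) : ∃ (g : ℝ) (h : ℕ → ℝ), ConvexUpTo M.Q h ∧
    ∀ n ≤ M.Q, h n + g = ν * n + M.minCost (M.nextMean h) n := by
  obtain ⟨F, hF, hfreq⟩ := exists_frequent_policy (M := M) ν
  obtain ⟨φ, hφ, hφV⟩ := extraction_of_frequently_atTop hfreq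
  choose V hV hVle hVeq using hφV
  obtain ⟨g, f, hf⟩ := hF.exists_isGain fun n => ν * n + M.P (n - F.level n)
  obtain ⟨C, hC⟩ := exists_abs_le f M.Q
  have hβ0 : ∀ k, 0 < 1 / ((φ k : ℝ) + 1) := fun k => by positivity
  have hβ1 : ∀ k, 0 ≤ 1 - 1 / ((φ k : ℝ) + 1) := fun k => by
    rw [sub_nonneg, div_le_one (by positivity)]
    linarith [(φ k).cast_nonneg (α := ℝ)]
  have hbd := fun k => abs_discounted_sub_le hF hf (hβ1 k) (by linarith [hβ0 k]) (hVeq k) hC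
  simp only [sub_sub_cancel] at hbd
  let W : ℕ → M.State → ℝ := fun k q => V k q - g / (1 / ((φ k : ℝ) + 1))
  have hW : ∀ k, W k ∈ Metric.closedBall (0 : M.State → ℝ) (2 * C) := fun k => by
    rw [mem_closedBall_zero_iff]
    refine (pi_norm_le_iff_of_nonneg ((abs_nonneg _).trans (hbd k 0 (Nat.zero_le _)))).2 fun q => ?_
    exact hbd k q (by omega)
  obtain ⟨v, -, ψ, hψ, hlim⟩ := tendsto_subseq_of_bounded Metric.isBounded_closedBall hW
  have hlim' : ∀ n ≤ M.Q, Tendsto (fun k => V (ψ k) n - g / (1 / ((φ (ψ k) : ℝ) + 1))) atTop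
      (𝓝 (M.extend v n)) := fun n hn => by
    rw [extend_apply v hn]
    exact tendsto_pi_nhds.1 hlim ⟨n, Nat.lt_succ_of_le hn⟩
  have hβlim : Tendsto (fun k => 1 - 1 / ((φ (ψ k) : ℝ) + 1)) atTop (𝓝 1) := by
    have h := ((tendsto_one_div_add_atTop_nhds_zero_nat (𝕜 := ℝ)).comp
      (hφ.comp hψ).tendsto_atTop).const_sub 1
    rwa [sub_zero] at h
  have hmean : ∀ n ≤ M.Q, ∀ y, M.AdmLevel n y → Tendsto (fun k => ν * n + M.P (n - y) +
      (1 - 1 / ((φ (ψ k) : ℝ) + 1)) *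
        M.nextMean (fun n => V (ψ k) n - g / (1 / ((φ (ψ k) : ℝ) + 1))) y) atTop
      (𝓝 (ν * n + M.P (n - y) + 1 * M.nextMean (M.extend v) y)) := fun n hn y hy =>
    (hβlim.mul (((hlim' y (hy.1.trans hn)).const_mul _).add
      ((hlim' _ hy.2.2).const_mul _))).const_add _
  -- Shifting the values by `g / (1 - β)` leaves a remainder `g`, because `(1 - β) * (g / (1 - β)) =
  -- g`; this is how the gain enters the limiting equation.
  have hshift : ∀ k y, (1 - 1 / ((φ (ψ k) : ℝ) + 1)) *
      M.nextMean (fun n => V (ψ k) n - g / (1 / ((φ (ψ k) : ℝ) + 1))) y =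
      (1 - 1 / ((φ (ψ k) : ℝ) + 1)) * M.nextMean (V (ψ k)) y -
        (g / (1 / ((φ (ψ k) : ℝ) + 1)) - g) := fun k y => by
    unfold nextMean
    field_simp
    ring
  have hle : ∀ n ≤ M.Q, ∀ y, M.AdmLevel n y →
      M.extend v n + g ≤ ν * n + M.P (n - y) + 1 * M.nextMean (M.extend v) y := fun n hn y hy =>
    le_of_tendsto_of_tendsto' ((hlim' n hn).add_const g) (hmean n hn y hy) fun k => by
      rw [hshift]
      linarith [hVle (ψ k) n hn y hy]
  have heq : ∀ n ≤ M.Q,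
      M.extend v n + g = ν * n + M.P (n - F.level n) + 1 * M.nextMean (M.extend v) (F.level n) :=
    fun n hn => tendsto_nhds_unique ((hlim' n hn).add_const g)
      ((hmean n hn _ (hF.adm n hn)).congr fun k => by
        rw [hshift]
        linarith [hVeq (ψ k) n hn])
  refine ⟨g, M.extend v, ConvexUpTo.of_tendsto (f := fun k n =>
    V (ψ k) n - g / (1 / ((φ (ψ k) : ℝ) + 1))) (fun k i hi => ?_) hlim', fun n hn => ?_⟩
  · have := hV (ψ k) i hi
    dsimp only
    linarith
  · have hmem : F.level n ∈ M.optLevels (M.nextMean (M.extend v)) n :=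
      ⟨hF.adm n hn, fun y hy => by linarith [hle n hn y hy, heq n hn]⟩
    rw [minCost_eq hmem hn, heq n hn]
    ring

end BufferModel

/-! ### Supporting lines and paths of optimal policies on them -/

namespace BufferModel

variable {M : BufferModel}

theorem MonoLevels.max {x y : ℕ → ℕ} (hx : M.MonoLevels x) (hy : M.MonoLevels y) :
    M.MonoLevels fun n => Max.max (x n) (y n) where
  adm q hq := by
    rcases max_cases (x q) (y q) with h | h <;> rw [h.1]
    exacts [hx.adm q hq, hy.adm q hq]
  le_succ q hq := by
    have := hx.le_succ q hq
    have := hy.le_succ q hq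
    omega
  succ_le q hq := by
    have := hx.succ_le q hq
    have := hy.succ_le q hq
    omega

theorem MonoLevels.min {x y : ℕ → ℕ} (hx : M.MonoLevels x) (hy : M.MonoLevels y) :
    M.MonoLevels fun n => Min.min (x n) (y n) where
  adm q hq := by
    rcases min_cases (x q) (y q) with h | h <;> rw [h.1]
    exacts [hx.adm q hq, hy.adm q hq]
  le_succ q hq := by
    have := hx.le_succ q hq
    have := hy.le_succ q hq
    omega
  succ_le q hq := by
    have := hx.succ_le q hq
    have := hy.succ_le q hq
    omega

/-- At the first state where `x` is below `y`, the function `x` is flat on the left, since `y`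
climbs by at most one. Raising `x` at the right end `r` of this plateau keeps all increments in `{0,
1}`, and `y`, being nondecreasing, is still above `x` there. -/
theorem MonoLevels.exists_raise {x y : ℕ → ℕ} (hx : M.MonoLevels x) (hy : M.MonoLevels y)
    (hne : ∃ n ≤ M.Q, x n < y n) :
    ∃ r ≤ M.Q, x r < y r ∧ M.MonoLevels (Function.update x r (x r + 1)) := by
  classical
  obtain ⟨haQ, halt⟩ := Nat.find_spec hne
  have hmin : ∀ m < Nat.find hne, m ≤ M.Q → ¬ x m < y m := fun m hm h1 h2 =>
    Nat.find_min hne hm ⟨h1, h2⟩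
  set a := Nat.find hne
  clear_value a
  have hy0 : y 0 ≤ 0 := (hy.adm 0 (Nat.zero_le _)).1
  have ha0 : a ≠ 0 := fun h => by rw [h] at halt; omega
  obtain ⟨b, rfl⟩ := Nat.exists_eq_succ_of_ne_zero ha0
  simp only [Nat.succ_eq_add_one] at *
  have h1 := hmin b (by omega) (by omega)
  have h2 := hy.succ_le b haQ
  have h3 := hx.le_succ b haQ
  have hspec : x (Nat.findGreatest (fun n => x n = x (b + 1)) M.Q) = x (b + 1) :=
    Nat.findGreatest_spec (P := fun n => x n = x (b + 1)) haQ rfl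
  have hrQ : Nat.findGreatest (fun n => x n = x (b + 1)) M.Q ≤ M.Q := Nat.findGreatest_le _
  have hbr : b + 1 ≤ Nat.findGreatest (fun n => x n = x (b + 1)) M.Q :=
    Nat.le_findGreatest haQ rfl
  have hgt : ∀ n ≤ M.Q, x n = x (b + 1) → n ≤ Nat.findGreatest (fun n => x n = x (b + 1)) M.Q :=
    fun n hn h => Nat.le_findGreatest hn h
  set r := Nat.findGreatest (fun n => x n = x (b + 1)) M.Q
  have h4 : x r < y r := by
    have := hy.level_mono hbr hrQ
    omega
  obtain ⟨x1, x2, x3⟩ := hx.adm r hrQ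
  obtain ⟨y1, y2, y3⟩ := hy.adm r hrQ
  refine ⟨r, hrQ, h4, ?_, ?_, ?_⟩
  · intro q hq
    rcases eq_or_ne q r with rfl | hqr
    · rw [Function.update_self]
      exact ⟨by omega, by omega, by omega⟩
    · rw [Function.update_of_ne hqr]
      exact hx.adm q hq
  · intro q hq
    have h5 := hx.le_succ q hq
    rcases eq_or_ne q r with h | hqr
    · have h6 : x (q + 1) ≠ x (b + 1) := fun h' => by have := hgt (q + 1) hq h'; omega
      rw [h, Function.update_self, Function.update_of_ne (by omega)]
      rw [h] at h5 h6
      omega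
    · rw [Function.update_of_ne hqr]
      rcases eq_or_ne (q + 1) r with h | hqr'
      · rw [h, Function.update_self]
        rw [h] at h5
        omega
      · rwa [Function.update_of_ne hqr']
  · intro q hq
    have h5 := hx.succ_le q hq
    rcases eq_or_ne q r with h | hqr
    · rw [h, Function.update_self, Function.update_of_ne (by omega)]
      rw [h] at h5
      omega
    · rw [Function.update_of_ne hqr]
      rcases eq_or_ne (q + 1) r with h | hqr'
      · have h6 : x b ≤ x q := hx.level_mono (by omega) (by omega)
        rw [h, Function.update_self]
        omega
      · rwa [Function.update_of_ne hqr']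

variable (M) in
/-- The average delay is this multiple of the average queue length. -/
noncomputable def delayScale : ℝ := 1 / (M.α * (M.A : ℝ))

theorem delayScale_pos : 0 < M.delayScale :=
  one_div_pos.2 (mul_pos M.α_pos (Nat.cast_pos.2 M.one_le_A))

variable (M) in
/-- The policy leaving `x q` packets in state `q` has average power `z.1` and average delay
`z.2`. -/
structure LevelPoint (x : ℕ → ℕ) (z : ℝ × ℝ) : Prop where
  power : M.IsGain x (fun n => M.P (n - x n)) z.1
  delay : M.IsGain x (fun n => M.delayScale * n) z.2

theorem MonoLevels.exists_levelPoint {x : ℕ → ℕ} (hx : M.MonoLevels x) : ∃ z, M.LevelPoint x z := by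
  obtain ⟨p, hp⟩ := hx.exists_isGain fun n => M.P (n - x n)
  obtain ⟨d, hd⟩ := hx.exists_isGain fun n => M.delayScale * n
  exact ⟨(p, d), hp, hd⟩

theorem LevelPoint.congr {x y : ℕ → ℕ} {z : ℝ × ℝ} (hz : M.LevelPoint x z)
    (h : ∀ n ≤ M.Q, y n = x n) : M.LevelPoint y z :=
  ⟨hz.power.congr h fun n hn => by rw [h n hn], hz.delay.congr h fun _ _ => rfl⟩

theorem MonoLevels.levelPoint_unique {x : ℕ → ℕ} (hx : M.MonoLevels x) {z z' : ℝ × ℝ}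
    (hz : M.LevelPoint x z) (hz' : M.LevelPoint x z') : z = z' :=
  Prod.ext (hx.isGain_unique hz.power hz'.power) (hx.isGain_unique hz.delay hz'.delay)

theorem LevelPoint.gain {x : ℕ → ℕ} {z : ℝ × ℝ} (hz : M.LevelPoint x z) (μ : ℝ) :
    M.IsGain x (fun n => M.P (n - x n) + μ * (M.delayScale * n)) (z.1 + μ * z.2) :=
  hz.power.add_mul hz.delay μ

theorem LevelPoint.obtains {x : ℕ → ℕ} (hx : ∀ q ≤ M.Q, M.AdmLevel q (x q)) {z : ℝ × ℝ}
    (hz : M.LevelPoint x z) (q₀ : M.State) :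
    M.Obtains (DetPolicy.ofLevels x hx).toPolicy q₀ z := by
  have hz' : M.LevelPoint (DetPolicy.ofLevels x hx).level z :=
    hz.congr fun n hn => DetPolicy.level_ofLevels hx hn
  set F := DetPolicy.ofLevels x hx
  obtain ⟨⟨f, hf⟩, ⟨f', hf'⟩⟩ := hz'
  refine ⟨F.tendsto_timeAverage q₀ (f := f) fun q => ?_, ?_⟩
  · rw [← F.level_coe, ← hf q (by omega)]
    dsimp only
    rw [F.level_coe]
    have := (F.allowed q).1
    exact congrArg M.P (by omega)
  · refine (F.tendsto_timeAverage q₀ (c := fun q _ => M.delayScale * (q : ℕ)) (f := f')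
      fun q => ?_).congr fun N => timeAverage_const_mul _ _ _ _ _
    rw [← F.level_coe, ← hf' q (by omega)]

variable (M) in
/-- The points obtained by the policies with monotone levels. -/
def monoPoints : Set (ℝ × ℝ) := {z | ∃ x, M.MonoLevels x ∧ M.LevelPoint x z}

theorem finite_monoPoints : M.monoPoints.Finite := by
  have h : M.monoPoints ⊆ ⋃ F : M.DetPolicy, {z | M.MonoLevels F.level ∧ M.LevelPoint F.level z} := by
    rintro z ⟨x, hx, hz⟩
    have h := fun n (hn : n ≤ M.Q) => DetPolicy.level_ofLevels hx.adm hn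
    exact Set.mem_iUnion.2 ⟨DetPolicy.ofLevels x hx.adm, hx.congr h, hz.congr h⟩
  refine (Set.finite_iUnion fun F => Set.Subsingleton.finite ?_).subset h
  rintro z ⟨hF, hz⟩ z' ⟨-, hz'⟩
  exact hF.levelPoint_unique hz hz'

theorem exists_policy_of_mem_monoPoints {z : ℝ × ℝ} (hz : z ∈ M.monoPoints) :
    ∃ F : M.DetPolicy, ∀ q₀, M.Obtains F.toPolicy q₀ z := by
  obtain ⟨x, hx, hz⟩ := hz
  exact ⟨_, hz.obtains hx.adm⟩

theorem mem_region_of_mem_monoPoints {z : ℝ × ℝ} (hz : z ∈ M.monoPoints) (q₀ : M.State) :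
    z ∈ M.region q₀ := by
  obtain ⟨F, hF⟩ := exists_policy_of_mem_monoPoints hz
  exact ⟨_, hF q₀⟩

variable (M) in
/-- `z` minimizes power plus `μ` times delay, compared with the points of `monoPoints`. -/
def OnFace (μ : ℝ) (z : ℝ × ℝ) : Prop := ∀ w ∈ M.monoPoints, z.1 + μ * z.2 ≤ w.1 + μ * w.2

variable (M) in
/-- A step along the tradeoff curve: the delay increases, the two points lie on a common face, and
they are obtained by deterministic policies that differ in one state. -/
structure CurveStep (z z' : ℝ × ℝ) : Prop where
  delay_lt : z.2 < z'.2
  left_mem : z ∈ M.monoPoints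
  right_mem : z' ∈ M.monoPoints
  face : ∃ μ, 0 ≤ μ ∧ M.OnFace μ z ∧ M.OnFace μ z'
  policies : ∃ F F' : M.DetPolicy, (∀ q₀, M.Obtains F.toPolicy q₀ z) ∧
    (∀ q₀, M.Obtains F'.toPolicy q₀ z') ∧ F.DifferInOneState F'

variable (M) in
/-- `g` and `h` solve the optimality equation for the cost power plus `μ` times delay. -/
structure OptimalitySolution (μ g : ℝ) (h : ℕ → ℝ) : Prop where
  convex : ConvexUpTo M.Q h
  eq : ∀ n ≤ M.Q, h n + g = μ * (M.delayScale * n) + M.minCost (M.nextMean h) n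

theorem exists_optimalitySolution (μ : ℝ) : ∃ g h, M.OptimalitySolution μ g h := by
  obtain ⟨g, h, hh, heq⟩ := exists_optimality_solution (M := M) (μ * M.delayScale)
  exact ⟨g, h, hh, fun n hn => by rw [heq n hn]; ring⟩

theorem OptimalitySolution.le_of_mem_region {μ g : ℝ} {h : ℕ → ℝ} (H : M.OptimalitySolution μ g h)
    {q₀ : M.State} {z : ℝ × ℝ} (hz : z ∈ M.region q₀) : g ≤ z.1 + μ * z.2 := by
  obtain ⟨γ, h1, h2⟩ := hz
  refine le_of_tendsto_timeAverage (γ := γ) (q₀ := q₀) (f := h)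
    (c := fun q s => M.P (s : ℕ) + μ * M.delayScale * (q : ℕ)) (fun q s hs => ?_)
    ((h1.add (h2.const_mul μ)).congr fun N => ?_)
  · have h3 := H.eq q (by omega)
    have h4 := minCost_le (w := M.nextMean h) hs.admLevel (by omega)
    have h5 := hs.1
    rw [show (q : ℕ) - ((q : ℕ) - (s : ℕ)) = s by omega] at h4
    linarith
  · rw [timeAverage_add γ q₀ (fun q s => M.P (s : ℕ)),
      timeAverage_const_mul γ q₀ _ (fun q _ => ((q : ℕ) : ℝ)), delayScale]
    ring

theorem OptimalitySolution.isGain {μ g : ℝ} {h : ℕ → ℝ} (H : M.OptimalitySolution μ g h)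
    {x : ℕ → ℕ} (hx : ∀ n ≤ M.Q, x n ∈ M.optLevels (M.nextMean h) n) :
    M.IsGain x (fun n => M.P (n - x n) + μ * (M.delayScale * n)) g :=
  ⟨h, fun n hn => by linarith [H.eq n hn, minCost_eq (hx n hn) hn]⟩

theorem OptimalitySolution.sum_eq {μ g : ℝ} {h : ℕ → ℝ} (H : M.OptimalitySolution μ g h)
    {x : ℕ → ℕ} (hx : M.MonoLevels x) (hopt : ∀ n ≤ M.Q, x n ∈ M.optLevels (M.nextMean h) n)
    {z : ℝ × ℝ} (hz : M.LevelPoint x z) : z.1 + μ * z.2 = g :=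
  hx.isGain_unique (hz.gain μ) (H.isGain hopt)

theorem OptimalitySolution.monoLevels_lo {μ g : ℝ} {h : ℕ → ℝ} (H : M.OptimalitySolution μ g h) :
    M.MonoLevels (M.loLevel (M.nextMean h)) :=
  BufferModel.monoLevels_lo (convexUpTo_nextMean H.convex)

theorem OptimalitySolution.monoLevels_hi {μ g : ℝ} {h : ℕ → ℝ} (H : M.OptimalitySolution μ g h) :
    M.MonoLevels (M.hiLevel (M.nextMean h)) :=
  BufferModel.monoLevels_hi (convexUpTo_nextMean H.convex)

/-- The least optimal levels attain `g`, which bounds the whole region from below. So comparing with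
monotone policies is as strong as comparing with all policies. -/
theorem OptimalitySolution.onFace_iff {μ g : ℝ} {h : ℕ → ℝ} (H : M.OptimalitySolution μ g h)
    {z : ℝ × ℝ} : M.OnFace μ z ↔ z.1 + μ * z.2 ≤ g := by
  constructor
  · intro hz
    have hlo := H.monoLevels_lo
    obtain ⟨w, hw⟩ := hlo.exists_levelPoint
    rw [← H.sum_eq hlo (fun n hn => loLevel_mem _ hn) hw]
    exact hz w ⟨_, hlo, hw⟩
  · exact fun hz w hw => hz.trans (H.le_of_mem_region (mem_region_of_mem_monoPoints hw 0))

theorem OnFace.le_of_mem_region {μ : ℝ} {z : ℝ × ℝ} (hz : M.OnFace μ z) {q₀ : M.State}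
    {w : ℝ × ℝ} (hw : w ∈ M.region q₀) : z.1 + μ * z.2 ≤ w.1 + μ * w.2 := by
  obtain ⟨g, h, H⟩ := exists_optimalitySolution (M := M) μ
  exact (H.onFace_iff.1 hz).trans (H.le_of_mem_region hw)

theorem differInOneState_ofLevels {x y : ℕ → ℕ} (hx : ∀ q ≤ M.Q, M.AdmLevel q (x q))
    (hy : ∀ q ≤ M.Q, M.AdmLevel q (y q)) {r : ℕ} (hr : r ≤ M.Q) (hne : x r ≠ y r)
    (heq : ∀ n ≤ M.Q, n ≠ r → x n = y n) :
    (DetPolicy.ofLevels x hx).DifferInOneState (DetPolicy.ofLevels y hy) := by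
  refine ⟨⟨r, Nat.lt_succ_of_le hr⟩, fun h => ?_, fun q hq => ?_⟩
  · have h1 := congrArg Fin.val h
    simp only [DetPolicy.ofLevels] at h1
    have := (hx r hr).1
    have := (hy r hr).1
    omega
  · have h1 := heq q (by omega) fun h => hq (Fin.ext h)
    simp only [DetPolicy.ofLevels, h1]

/-- Induction on the total gap `N` between the levels. Each raised policy lies between optimal
levels, so it stays optimal and on the supporting line. -/
theorem OptimalitySolution.reflTransGen {μ g : ℝ} (hμ : 0 ≤ μ) {h : ℕ → ℝ}
    (H : M.OptimalitySolution μ g h) {y : ℕ → ℕ} (hy : M.MonoLevels y)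
    (hyo : ∀ n ≤ M.Q, y n ∈ M.optLevels (M.nextMean h) n) {w : ℝ × ℝ} (hw : M.LevelPoint y w)
    (N : ℕ) : ∀ {x : ℕ → ℕ}, M.MonoLevels x → (∀ n ≤ M.Q, x n ∈ M.optLevels (M.nextMean h) n) →
      (∀ n ≤ M.Q, x n ≤ y n) → ∑ n ∈ Finset.range (M.Q + 1), (y n - x n) = N →
      ∀ {z : ℝ × ℝ}, M.LevelPoint x z → Relation.ReflTransGen M.CurveStep z w := by
  induction N with
  | zero =>
    intro x hx hxo hxy hsum z hz
    rw [Finset.sum_eq_zero_iff] at hsum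
    have heq : ∀ n ≤ M.Q, y n = x n := fun n hn => by
      have h1 := hsum n (Finset.mem_range.2 (by omega))
      have h2 := hxy n hn
      omega
    rw [hy.levelPoint_unique (hz.congr heq) hw]
  | succ N ih =>
    intro x hx hxo hxy hsum z hz
    have hne : ∃ n ≤ M.Q, x n < y n := by
      by_contra! hle
      rw [Finset.sum_eq_zero fun n hn => by
        have := hle n (by have := Finset.mem_range.1 hn; omega)
        omega] at hsum
      omega
    obtain ⟨r, hr, hlt, hx'⟩ := hx.exists_raise hy hne
    have hself : Function.update x r (x r + 1) r = x r + 1 := Function.update_self ..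
    have hother : ∀ n, n ≠ r → Function.update x r (x r + 1) n = x n := fun n hn =>
      Function.update_of_ne hn ..
    generalize Function.update x r (x r + 1) = x' at *
    have hxx' : ∀ n ≤ M.Q, x n ≤ x' n := fun n _ => by
      rcases eq_or_ne n r with rfl | hnr
      · omega
      · rw [hother n hnr]
    have hx'y : ∀ n ≤ M.Q, x' n ≤ y n := fun n hn => by
      rcases eq_or_ne n r with rfl | hnr
      · omega
      · rw [hother n hnr]
        exact hxy n hn
    have hx'o : ∀ n ≤ M.Q, x' n ∈ M.optLevels (M.nextMean h) n := fun n hn =>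
      mem_optLevels_of_between (convexUpTo_nextMean H.convex) (hxo n hn) (hyo n hn) (hxx' n hn)
        (hx'y n hn)
    obtain ⟨z', hz'⟩ := hx'.exists_levelPoint
    have hsum' : ∑ n ∈ Finset.range (M.Q + 1), (y n - x' n) = N := by
      have hmem : r ∈ Finset.range (M.Q + 1) := Finset.mem_range.2 (by omega)
      rw [← Finset.add_sum_erase _ _ hmem] at hsum ⊢
      rw [Finset.sum_congr rfl fun n hn => by rw [hother n (Finset.ne_of_mem_erase hn)], hself]
      omega
    have htail := ih hx' hx'o hx'y hsum' hz'
    have hD : z.2 ≤ z'.2 := hx.isGain_mono hx' hxx'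
      (fun a _ b _ hab => mul_le_mul_of_nonneg_left (Nat.cast_le.2 hab) delayScale_pos.le)
      hz.delay hz'.delay
    have hsz := H.sum_eq hx hxo hz
    have hsz' := H.sum_eq hx' hx'o hz'
    -- If the delay does not grow, the line forces the two points to coincide, and the raise
    -- contributes no step.
    rcases hD.eq_or_lt with hD | hD
    · rw [hD] at hsz
      rwa [show z = z' from Prod.ext (by linarith) hD]
    · refine .head ⟨hD, ⟨x, hx, hz⟩, ⟨x', hx', hz'⟩, ⟨μ, hμ, H.onFace_iff.2 hsz.le,
        H.onFace_iff.2 hsz'.le⟩, _, _, hz.obtains hx.adm, hz'.obtains hx'.adm,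
        differInOneState_ofLevels _ _ hr (by omega) fun n _ hn => (hother n hn).symm⟩ htail

/-- A policy of optimal gain may act suboptimally in transient states. With `f` from its Poisson
equation, `h - f` is subharmonic; on the closed class where it is maximal there is equality, so the
actions there are minimizing. -/
theorem OptimalitySolution.exists_conserving_class {μ g : ℝ} {h : ℕ → ℝ}
    (H : M.OptimalitySolution μ g h) {x : ℕ → ℕ} (hx : M.MonoLevels x) {z : ℝ × ℝ}
    (hz : M.LevelPoint x z) (hface : z.1 + μ * z.2 ≤ g) :
    ∃ U, M.ClosedClass x U ∧ ∀ n ∈ U, x n ∈ M.optLevels (M.nextMean h) n := by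
  have hzg : z.1 + μ * z.2 = g :=
    le_antisymm hface (H.le_of_mem_region (mem_region_of_mem_monoPoints ⟨x, hx, hz⟩ 0))
  obtain ⟨f, hf⟩ := hz.gain μ
  rw [hzg] at hf
  have hle : ∀ n ≤ M.Q, h n - f n ≤ M.nextMean (fun n => h n - f n) (x n) := fun n hn => by
    rw [nextMean_sub]
    linarith [hf n hn, H.eq n hn, minCost_le (w := M.nextMean h) (hx.adm n hn) hn]
  obtain ⟨m, hm, hmax⟩ := Set.exists_max_image (Set.Iic M.Q) (fun n => h n - f n)
    (Set.finite_Iic _) ⟨0, Nat.zero_le _⟩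
  have hU := closedClass_argmax hx.adm hle hmax ⟨m, hm, rfl⟩
  refine ⟨_, hU, fun n hn => ?_⟩
  have h1 := (hU.level_mem n hn).2
  have h2 := (hU.level_add_mem n hn).2
  have h3 : M.nextMean (fun n => h n - f n) (x n) ≤ h m - f m := nextMean_le h1.le h2.le
  rw [nextMean_sub, ← hn.2] at h3
  refine ⟨hx.adm n hn.1, fun y hy => ?_⟩
  linarith [hf n hn.1, H.eq n hn.1, minCost_le (w := M.nextMean h) hy hn.1]

theorem OptimalitySolution.delay_bounds {μ g : ℝ} {h : ℕ → ℝ}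
    (H : M.OptimalitySolution μ g h) {z lo hi : ℝ × ℝ} (hz : z ∈ M.monoPoints)
    (hface : M.OnFace μ z) (hlo : M.LevelPoint (M.loLevel (M.nextMean h)) lo)
    (hhi : M.LevelPoint (M.hiLevel (M.nextMean h)) hi) : lo.2 ≤ z.2 ∧ z.2 ≤ hi.2 := by
  obtain ⟨x, hx, hz⟩ := hz
  obtain ⟨U, hU, hopt⟩ := H.exists_conserving_class hx hz (H.onFace_iff.1 hface)
  have hl := H.monoLevels_lo
  have hh := H.monoLevels_hi
  -- Clamping `x` between the extreme optimal levels changes nothing on `U`, hence not the delay,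
  -- and makes the levels comparable in every state.
  have hy := hl.max (hh.min hx)
  obtain ⟨w, hw⟩ := hy.exists_levelPoint
  have hzw : z.2 = w.2 := hU.isGain_unique hz.delay hw.delay (fun n hn => by
    have h1 := loLevel_le (hopt n hn)
    have h2 := le_hiLevel (hopt n hn)
    omega) fun _ _ => rfl
  have hc : MonotoneOn (fun n : ℕ => M.delayScale * n) (Set.Iic M.Q) := fun a _ b _ hab =>
    mul_le_mul_of_nonneg_left (Nat.cast_le.2 hab) delayScale_pos.le
  rw [hzw]
  refine ⟨hl.isGain_mono hy (fun n _ => le_max_left _ _) hc hlo.delay hw.delay,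
    hy.isGain_mono hh (fun n hn => ?_) hc hw.delay hhi.delay⟩
  have := loLevel_le (hiLevel_mem (M := M) (M.nextMean h) hn)
  omega

theorem exists_face_path {μ : ℝ} (hμ : 0 ≤ μ) : ∃ lo ∈ M.monoPoints, ∃ hi ∈ M.monoPoints,
    M.OnFace μ lo ∧ M.OnFace μ hi ∧ Relation.ReflTransGen M.CurveStep lo hi ∧
      ∀ z ∈ M.monoPoints, M.OnFace μ z → lo.2 ≤ z.2 ∧ z.2 ≤ hi.2 := by
  obtain ⟨g, h, H⟩ := exists_optimalitySolution (M := M) μ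
  have hl := H.monoLevels_lo
  have hh := H.monoLevels_hi
  obtain ⟨lo, hlo⟩ := hl.exists_levelPoint
  obtain ⟨hi, hhi⟩ := hh.exists_levelPoint
  exact ⟨lo, ⟨_, hl, hlo⟩, hi, ⟨_, hh, hhi⟩,
    H.onFace_iff.2 (H.sum_eq hl (fun n hn => loLevel_mem _ hn) hlo).le,
    H.onFace_iff.2 (H.sum_eq hh (fun n hn => hiLevel_mem _ hn) hhi).le,
    H.reflTransGen hμ hh (fun n hn => hiLevel_mem _ hn) hhi _ hl (fun n hn => loLevel_mem _ hn)
      (fun n hn => loLevel_le (hiLevel_mem _ hn)) rfl hlo,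
    fun z hz hf => H.delay_bounds hz hf hlo hhi⟩

end BufferModel

/-! ### Convexity of the region and its point of least delay -/

namespace BufferModel

variable {M : BufferModel}

/-- The weight of a history under the mixture of two policies. -/
noncomputable def Policy.mixWeight (γ γ' : M.Policy) (q₀ : M.State) (a b : ℝ)
    (h : List (M.State × M.Action)) (q : M.State) : ℝ :=
  a * M.histProb γ q₀ h q + b * M.histProb γ' q₀ h q

theorem Policy.mixWeight_nonneg (γ γ' : M.Policy) (q₀ : M.State) {a b : ℝ} (ha : 0 ≤ a)
    (hb : 0 ≤ b) (h : List (M.State × M.Action)) (q : M.State) :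
    0 ≤ γ.mixWeight γ' q₀ a b h q :=
  add_nonneg (mul_nonneg ha (histProb_nonneg _ _ _ _)) (mul_nonneg hb (histProb_nonneg _ _ _ _))

open scoped Classical in
/-- The policy that behaves, from the initial state `q₀` on, as the random choice of `γ` with
probability `a` and of `γ'` with probability `b`. -/
noncomputable def Policy.mix (γ γ' : M.Policy) (q₀ : M.State) {a b : ℝ} (ha : 0 ≤ a)
    (hb : 0 ≤ b) : M.Policy where
  -- The posterior mixture of the two rules. On histories of weight zero any feasible rule would do;
  -- both contributions vanish there.
  rule h q s := if γ.mixWeight γ' q₀ a b h q = 0 then γ.rule h q s else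
    (a * M.histProb γ q₀ h q * γ.rule h q s + b * M.histProb γ' q₀ h q * γ'.rule h q s) /
      γ.mixWeight γ' q₀ a b h q
  nonneg h q s := by
    split_ifs
    · exact γ.nonneg h q s
    · exact div_nonneg (add_nonneg
        (mul_nonneg (mul_nonneg ha (histProb_nonneg _ _ _ _)) (γ.nonneg h q s))
        (mul_nonneg (mul_nonneg hb (histProb_nonneg _ _ _ _)) (γ'.nonneg h q s)))
        (γ.mixWeight_nonneg γ' q₀ ha hb h q)
  sum_eq_one h q := by
    split_ifs with h0
    · exact γ.sum_eq_one h q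
    · rw [← Finset.sum_div, Finset.sum_add_distrib, ← Finset.mul_sum, ← Finset.mul_sum,
        γ.sum_eq_one, γ'.sum_eq_one, mul_one, mul_one]
      exact div_self h0
  feasible h q s hs := by
    simp [γ.feasible h q s hs, γ'.feasible h q s hs]

theorem Policy.mixWeight_mul_rule (γ γ' : M.Policy) (q₀ : M.State) {a b : ℝ} (ha : 0 ≤ a)
    (hb : 0 ≤ b) (h : List (M.State × M.Action)) (q : M.State) (s : M.Action) :
    γ.mixWeight γ' q₀ a b h q * (γ.mix γ' q₀ ha hb).rule h q s =
      a * M.histProb γ q₀ h q * γ.rule h q s + b * M.histProb γ' q₀ h q * γ'.rule h q s := by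
  by_cases h0 : γ.mixWeight γ' q₀ a b h q = 0
  · have h1 := mul_nonneg ha (histProb_nonneg γ q₀ h q)
    have h2 := mul_nonneg hb (histProb_nonneg γ' q₀ h q)
    have h3 : a * M.histProb γ q₀ h q + b * M.histProb γ' q₀ h q = 0 := h0
    rw [h0, show a * M.histProb γ q₀ h q = 0 by linarith,
      show b * M.histProb γ' q₀ h q = 0 by linarith]
    ring
  · simp only [Policy.mix, if_neg h0]
    exact mul_div_cancel₀ _ h0

theorem Policy.histProb_mix (γ γ' : M.Policy) (q₀ : M.State) {a b : ℝ} (ha : 0 ≤ a)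
    (hb : 0 ≤ b) (hab : a + b = 1) :
    ∀ h q, M.histProb (γ.mix γ' q₀ ha hb) q₀ h q = γ.mixWeight γ' q₀ a b h q
  | [], q => by
    simp only [mixWeight, histProb]
    split_ifs
    · linarith
    · ring
  | (q', s') :: h, q => by
    rw [histProb, histProb_mix γ γ' q₀ ha hb hab h q', mixWeight_mul_rule, mixWeight, histProb,
      histProb]
    ring

theorem Policy.stageMean_mix (γ γ' : M.Policy) (q₀ : M.State) {a b : ℝ} (ha : 0 ≤ a)
    (hb : 0 ≤ b) (hab : a + b = 1) (c : M.State → M.Action → ℝ) (k : ℕ) :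
    M.stageMean (γ.mix γ' q₀ ha hb) q₀ c k =
      a * M.stageMean γ q₀ c k + b * M.stageMean γ' q₀ c k := by
  unfold stageMean
  simp only [Finset.mul_sum, ← Finset.sum_add_distrib]
  refine Finset.sum_congr rfl fun v _ => Finset.sum_congr rfl fun q _ =>
    Finset.sum_congr rfl fun s _ => ?_
  rw [histProb_mix γ γ' q₀ ha hb hab, mixWeight_mul_rule]
  ring

theorem Policy.timeAverage_mix (γ γ' : M.Policy) (q₀ : M.State) {a b : ℝ} (ha : 0 ≤ a)
    (hb : 0 ≤ b) (hab : a + b = 1) (c : M.State → M.Action → ℝ) (N : ℕ) :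
    M.timeAverage (γ.mix γ' q₀ ha hb) q₀ c N =
      a * M.timeAverage γ q₀ c N + b * M.timeAverage γ' q₀ c N := by
  unfold timeAverage
  simp only [stageMean_mix γ γ' q₀ ha hb hab, Finset.sum_add_distrib, ← Finset.mul_sum]
  ring

theorem convex_region (q₀ : M.State) : Convex ℝ (M.region q₀) := by
  rintro z ⟨γ, h1, h2⟩ z' ⟨γ', h1', h2'⟩ a b ha hb hab
  refine ⟨γ.mix γ' q₀ ha hb, ?_, ?_⟩
  · exact ((h1.const_mul a).add (h1'.const_mul b)).congr fun N =>
      (γ.timeAverage_mix γ' q₀ ha hb hab _ N).symm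
  · refine ((h2.const_mul a).add (h2'.const_mul b)).congr fun N => ?_
    rw [γ.timeAverage_mix γ' q₀ ha hb hab]
    ring

/-- With `f` the power itself, the left side vanishes whenever the buffer is emptied. Otherwise the
residual level is at least 1, and a constant bounding the finitely many values suffices. -/
theorem exists_power_bound (M : BufferModel) :
    ∃ (K : ℝ) (f : ℕ → ℝ), ∀ (q : M.State) (s : M.Action), M.Allowed q s →
      |M.P s - M.α * M.P M.A - (f q - M.nextMean f ((q : ℕ) - (s : ℕ)))| ≤
        K * (((q : ℕ) - (s : ℕ) : ℕ) : ℝ) := by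
  let u : M.State × M.Action → ℝ := fun p => |M.P p.2 - M.α * M.P M.A -
    (M.P p.1 - M.nextMean M.P ((p.1 : ℕ) - (p.2 : ℕ)))|
  have hu0 : ∀ p, 0 ≤ u p := fun p => abs_nonneg _
  have hu : ∀ p, u p ≤ ∑ p, u p := fun p =>
    Finset.single_le_sum (f := u) (fun p _ => hu0 p) (Finset.mem_univ p)
  refine ⟨∑ p, u p, M.P, fun q s hs => ?_⟩
  rcases Nat.eq_zero_or_pos ((q : ℕ) - (s : ℕ)) with h0 | h0
  · have h1 := hs.1
    rw [h0, show (q : ℕ) = s by omega, nextMean, M.P_zero, zero_add, Nat.cast_zero, mul_zero, mul_zero]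
    rw [abs_nonpos_iff]
    ring
  · refine (hu (q, s)).trans (le_mul_of_one_le_right ?_ (Nat.one_le_cast.2 h0))
    exact Finset.sum_nonneg fun p _ => hu0 p

theorem delayScale_mul (M : BufferModel) : M.delayScale * (M.α * M.A) = 1 :=
  one_div_mul_cancel (mul_pos M.α_pos (Nat.cast_pos.2 M.one_le_A)).ne'

/-- By the drift of the queue length, the average residual level is `α * A * (D - 1)`. Averaging
`exists_power_bound` then confines the region to a cone with apex at delay 1. -/
theorem exists_power_delay_bound (M : BufferModel) : ∃ K : ℝ, ∀ q₀ : M.State, ∀ z ∈ M.region q₀,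
    1 ≤ z.2 ∧ |z.1 - M.α * M.P M.A| ≤ K * (z.2 - 1) := by
  obtain ⟨K, f, hf⟩ := exists_power_bound M
  have hmean : ∀ x : ℕ, M.nextMean (fun n => (n : ℝ)) x = x + M.α * M.A := fun x => by
    unfold nextMean
    push_cast
    ring
  have hscale := delayScale_mul M
  have hpos := delayScale_pos (M := M)
  have hsub : ∀ {q : M.State} {s : M.Action}, M.Allowed q s →
      (((q : ℕ) - (s : ℕ) : ℕ) : ℝ) = (q : ℕ) - (s : ℕ) := fun hs => Nat.cast_sub hs.1
  refine ⟨K * (M.α * M.A), ?_⟩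
  rintro q₀ z ⟨γ, h1, h2⟩
  have h3 : Tendsto (M.timeAverage γ q₀ fun q _ => ((q : ℕ) : ℝ)) atTop
      (𝓝 (M.α * M.A * z.2)) := by
    refine (h2.const_mul (M.α * M.A)).congr fun N => ?_
    rw [← mul_assoc, ← delayScale, mul_comm (M.α * (M.A : ℝ)), hscale, one_mul]
  have h4 : Tendsto (M.timeAverage γ q₀ fun q s => (((q : ℕ) - (s : ℕ) : ℕ) : ℝ)) atTop
      (𝓝 (M.α * M.A * z.2 - M.α * M.A)) := by
    have h5 := h3.sub (tendsto_timeAverage_const_add_drift γ q₀ (M.α * M.A) fun n => (n : ℝ))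
    refine h5.congr fun N => ?_
    rw [sub_eq_iff_eq_add, ← timeAverage_add]
    refine congrArg (fun c => M.timeAverage γ q₀ c N) ?_
    funext q s
    rw [hmean]
    ring
  have h0 : 0 ≤ M.α * M.A * z.2 - M.α * M.A :=
    le_of_tendsto_timeAverage (f := fun _ => 0) (fun q s _ => by simp [nextMean]) h4
  have hαA : 0 < M.α * M.A := mul_pos M.α_pos (Nat.cast_pos.2 M.one_le_A)
  refine ⟨?_, abs_le'.2 ⟨?_, ?_⟩⟩
  · have : 0 ≤ M.α * M.A * (z.2 - 1) := by linarith
    linarith [nonneg_of_mul_nonneg_right this hαA]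
  · have h5 := le_of_tendsto_timeAverage (γ := γ) (q₀ := q₀) (g := -(M.α * M.P M.A))
      (f := fun n => - f n) (fun q s hs => ?_) ((h4.const_mul K).sub h1 |>.congr fun N =>
        show _ = M.timeAverage γ q₀ (fun q s => K * (((q : ℕ) - (s : ℕ) : ℕ) : ℝ) +
          (-1) * M.P (s : ℕ)) N by
        rw [timeAverage_add, timeAverage_const_mul, timeAverage_const_mul]
        ring)
    · linarith
    · rw [nextMean_neg]
      linarith [(abs_le.1 (hf q s hs)).2]
  · have h5 := le_of_tendsto_timeAverage (γ := γ) (q₀ := q₀) (g := M.α * M.P M.A)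
      (f := f) (fun q s hs => ?_) ((h4.const_mul K).add h1 |>.congr fun N =>
        show _ = M.timeAverage γ q₀ (fun q s => K * (((q : ℕ) - (s : ℕ) : ℕ) : ℝ) +
          M.P (s : ℕ)) N by
        rw [timeAverage_add, timeAverage_const_mul])
    · linarith
    · linarith [(abs_le.1 (hf q s hs)).1]

/-- Transmit as much as possible: since `A ≤ S`, the states `0` and `A` form a closed class on which
the buffer is always emptied. -/
theorem exists_delay_eq_one (M : BufferModel) : ∃ z ∈ M.monoPoints, z.2 = 1 := by
  have hx : M.MonoLevels fun n => n - M.S := by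
    have := M.A_le_S
    have := M.A_le_Q
    refine ⟨fun q hq => ⟨?_, ?_, ?_⟩, fun q hq => ?_, fun q hq => ?_⟩ <;> omega
  obtain ⟨z, hz⟩ := hx.exists_levelPoint
  refine ⟨z, ⟨_, hx, hz⟩, ?_⟩
  have hAS := M.A_le_S
  have hU : M.ClosedClass (fun n => n - M.S) ({0, M.A} : Set ℕ) := by
    have := M.A_le_Q
    refine ⟨⟨0, Or.inl rfl⟩, ?_, ?_, ?_⟩ <;> rintro n (rfl | rfl)
    · exact Nat.zero_le _
    · exact M.A_le_Q
    · exact Or.inl (by omega)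
    · exact Or.inl (by omega)
    · exact Or.inr (show 0 - M.S + M.A = M.A by omega)
    · exact Or.inr (show M.A - M.S + M.A = M.A by omega)
  obtain ⟨f, hf⟩ := hz.delay
  refine sub_eq_zero.1 (hU.gain_eq_zero (f := fun n => f n - M.delayScale * n) fun n hn => ?_)
  have h1 := hf n (hU.le n hn)
  have h2 : n - M.S = 0 := by
    rcases hn with rfl | rfl <;> omega
  have h3 := delayScale_mul M
  rw [nextMean_sub, h2]
  dsimp only at h1
  rw [h2] at h1
  have h4 : M.nextMean (fun n => M.delayScale * (n : ℝ)) 0 = 1 := by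
    rw [nextMean, ← h3]
    push_cast
    ring
  rw [h4]
  linarith

end BufferModel

/-! ### The tradeoff curve as a finite chain of faces -/

theorem Fin.eq_or_exists_between {n : ℕ} (f : Fin (n + 1) → ℝ) {p : ℝ} (h0 : f 0 ≤ p)
    (h1 : p ≤ f (Fin.last n)) : p = f 0 ∨ ∃ i : Fin n, f i.castSucc ≤ p ∧ p ≤ f i.succ := by
  by_contra! h
  have key : ∀ i, p ≤ f i → p = f 0 := fun i => by
    induction i using Fin.induction with
    | zero => exact fun hp => le_antisymm hp h0
    | succ i ih =>
      intro hp
      rcases le_total (f i.castSucc) p with hi | hi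
      · exact absurd hp (not_le.2 (h.2 i hi))
      · exact ih hi
  exact h.1 (key _ h1)

theorem exists_fin_sequence_of_reflTransGen {β : Type*} {r : β → β → Prop} {a b : β}
    (h : Relation.ReflTransGen r a b) : ∃ (n : ℕ) (z : Fin (n + 1) → β), z 0 = a ∧
      z (Fin.last n) = b ∧ ∀ i : Fin n, r (z i.castSucc) (z i.succ) := by
  induction h using Relation.ReflTransGen.head_induction_on with
  | refl => exact ⟨0, fun _ => b, rfl, rfl, fun i => i.elim0⟩
  | @head a c hac _ ih =>
    obtain ⟨n, z, h0, h1, h2⟩ := ih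
    refine ⟨n + 1, Fin.cons a z, rfl, ?_, fun i => ?_⟩
    · rw [← Fin.succ_last, Fin.cons_succ, h1]
    · refine Fin.cases ?_ (fun j => ?_) i
      · rw [Fin.castSucc_zero, Fin.cons_zero, Fin.cons_succ, h0]
        exact hac
      · rw [← Fin.succ_castSucc, Fin.cons_succ, Fin.cons_succ]
        exact h2 j

theorem exists_mem_segment_map_eq {E : Type*} [AddCommGroup E] [Module ℝ E] (f : E →ₗ[ℝ] ℝ)
    {a b : E} {p : ℝ} (ha : f a ≤ p) (hb : p ≤ f b) : ∃ v ∈ segment ℝ a b, f v = p := by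
  have h := Icc_subset_segment (𝕜 := ℝ) ⟨ha, hb⟩
  have h' := image_segment ℝ f.toAffineMap a b
  simp only [LinearMap.coe_toAffineMap] at h'
  rw [← h'] at h
  exact h

namespace BufferModel

variable {M : BufferModel}

theorem OnFace.mem_tradeoffCurve {μ : ℝ} {z : ℝ × ℝ} (hz : M.OnFace μ z) (hμ : 0 ≤ μ)
    {q₀ : M.State} (hR : z ∈ M.region q₀) : z ∈ M.tradeoffCurve q₀ := by
  refine ⟨hR, fun w hw => ?_⟩
  by_contra! h
  have h1 := hz.le_of_mem_region hw
  have h2 := mul_le_mul_of_nonneg_left h.2.le hμ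
  linarith [h.1]

theorem OnFace.eq_of_delay_eq {μ μ' : ℝ} {z w : ℝ × ℝ} (hz : M.OnFace μ z) (hw : M.OnFace μ' w)
    {q₀ : M.State} (hzR : z ∈ M.region q₀) (hwR : w ∈ M.region q₀) (h : z.2 = w.2) : z = w := by
  have h1 := hz.le_of_mem_region hwR
  have h2 := hw.le_of_mem_region hzR
  rw [h] at h1 h2
  exact Prod.ext (by linarith) h

theorem OnFace.delay_le {μ μ' : ℝ} {z w : ℝ × ℝ} (hz : M.OnFace μ z) (hw : M.OnFace μ' w)
    {q₀ : M.State} (hzR : z ∈ M.region q₀) (hwR : w ∈ M.region q₀) (h : μ' < μ) : z.2 ≤ w.2 := by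
  have h1 := hz.le_of_mem_region hwR
  have h2 := hw.le_of_mem_region hzR
  nlinarith

theorem OnFace.mem_segment {μ : ℝ} {a b z : ℝ × ℝ} (ha : M.OnFace μ a) (hb : M.OnFace μ b)
    (hz : z ∈ segment ℝ a b) : M.OnFace μ z := by
  obtain ⟨s, t, hs, ht, hst, rfl⟩ := hz
  intro w hw
  have h1 := mul_le_mul_of_nonneg_left (ha w hw) hs
  have h2 := mul_le_mul_of_nonneg_left (hb w hw) ht
  have h3 : s * (w.1 + μ * w.2) + t * (w.1 + μ * w.2) = w.1 + μ * w.2 := by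
    rw [← add_mul, hst, one_mul]
  simp only [Prod.fst_add, Prod.snd_add, Prod.smul_fst, Prod.smul_snd, smul_eq_mul]
  linarith

theorem exists_min_delay_vertex (M : BufferModel) : ∃ z ∈ M.monoPoints, ∃ μ, 0 ≤ μ ∧ M.OnFace μ z ∧
    (∀ w ∈ M.monoPoints, M.OnFace μ w → w.2 ≤ z.2) ∧
    ∀ q₀, ∀ w ∈ M.region q₀, z.2 ≤ w.2 ∧ (w.2 = z.2 → w = z) := by
  obtain ⟨z, hz, hz1⟩ := exists_delay_eq_one M
  obtain ⟨K, hK⟩ := exists_power_delay_bound M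
  have hp : ∀ q₀, ∀ w ∈ M.region q₀, w.2 = 1 → w.1 = M.α * M.P M.A := fun q₀ w hw h => by
    have h1 := (hK q₀ w hw).2
    rw [h, sub_self, mul_zero] at h1
    exact sub_eq_zero.1 (abs_eq_zero.1 (le_antisymm h1 (abs_nonneg _)))
  have hzp := hp 0 z (mem_region_of_mem_monoPoints hz 0) hz1
  have hKmax := le_max_left K 0
  -- A multiplier strictly larger than the slope `K` of the cone, so that the supporting line meets
  -- the cone only at its apex.
  refine ⟨z, hz, max K 0 + 1, by positivity, fun w hw => ?_, fun w hw hface => ?_,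
    fun q₀ w hw => ⟨hz1 ▸ (hK q₀ w hw).1, fun h => ?_⟩⟩
  · obtain ⟨h1, h2⟩ := hK 0 w (mem_region_of_mem_monoPoints hw 0)
    rw [hzp, hz1]
    nlinarith [(abs_le.1 h2).1]
  · obtain ⟨h1, h2⟩ := hK 0 w (mem_region_of_mem_monoPoints hw 0)
    have h3 := hface z hz
    rw [hzp, hz1] at h3
    rw [hz1]
    nlinarith [(abs_le.1 h2).1]
  · exact Prod.ext ((hp q₀ w hw (h.trans hz1)).trans hzp.symm) h

/-- The open quadrant below and to the left of `z` misses the convex region. A separating functional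
has nonnegative coefficients `a`, `b`, and `μ` is their ratio `b / a`. -/
theorem exists_onFace_of_mem_tradeoffCurve {q₀ : M.State} {z : ℝ × ℝ}
    (hz : z ∈ M.tradeoffCurve q₀) : ∃ μ, 0 ≤ μ ∧ M.OnFace μ z := by
  obtain ⟨hzR, hpar⟩ := hz
  have hopen : IsOpen (Set.Iio z.1 ×ˢ Set.Iio z.2) := isOpen_Iio.prod isOpen_Iio
  have hconv : Convex ℝ (Set.Iio z.1 ×ˢ Set.Iio z.2) := (convex_Iio _).prod (convex_Iio _)
  have hdisj : Disjoint (Set.Iio z.1 ×ˢ Set.Iio z.2) (M.region q₀) :=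
    Set.disjoint_left.2 fun w hw hwR =>
      (hpar w hwR).elim (fun h => absurd hw.1 (not_lt.2 h)) fun h => absurd hw.2 (not_lt.2 h)
  obtain ⟨f, u, hfu, huf⟩ := geometric_hahn_banach_open hconv hopen (convex_region q₀) hdisj
  have hf : ∀ w : ℝ × ℝ, f w = w.1 * f (1, 0) + w.2 * f (0, 1) := fun w => by
    rw [← smul_eq_mul, ← smul_eq_mul, ← map_smul, ← map_smul, ← map_add]
    simp
  set a := f (1, 0)
  set b := f (0, 1)
  have hpos : ∀ s t : ℝ, 0 < s → 0 < t → z.1 * a + z.2 * b - u < s * a + t * b := fun s t hs ht => by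
    have h := hfu (z.1 - s, z.2 - t) ⟨by simpa using hs, by simpa using ht⟩
    rw [hf] at h
    linarith
  have hzu := huf z hzR
  rw [hf] at hzu
  have ha : 0 ≤ a := by
    by_contra! h
    have h1 := hpos (1 + |b| / (-a)) 1 (by have := neg_pos.2 h; positivity) one_pos
    have h2 : |b| / (-a) * a = -|b| := by
      rw [div_neg, neg_mul, div_mul_cancel₀ _ h.ne]
    nlinarith [le_abs_self b]
  have hb : 0 ≤ b := by
    by_contra! h
    have h1 := hpos 1 (1 + |a| / (-b)) one_pos (by have := neg_pos.2 h; positivity)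
    have h2 : |a| / (-b) * b = -|a| := by
      rw [div_neg, neg_mul, div_mul_cancel₀ _ h.ne]
    nlinarith [le_abs_self a]
  have hle : z.1 * a + z.2 * b ≤ u := by
    by_contra! h
    have hδ : 0 < (z.1 * a + z.2 * b - u) / (a + b + 1) := div_pos (by linarith) (by linarith)
    have h1 := hpos _ _ hδ hδ
    have h2 := div_mul_cancel₀ (z.1 * a + z.2 * b - u) (show a + b + 1 ≠ 0 by linarith)
    linarith
  have hmin : ∀ w ∈ M.region q₀, z.1 * a + z.2 * b ≤ w.1 * a + w.2 * b := fun w hw => by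
    have := huf w hw
    rw [hf] at this
    linarith
  -- If `a = 0`, then `z` has least delay, hence is the apex, which has a finite multiplier of its
  -- own.
  rcases ha.eq_or_lt with ha | ha
  · obtain ⟨z₀, hz₀, μ, hμ, hface, -, hz₀min⟩ := exists_min_delay_vertex M
    have hb' : 0 < b := by
      have h1 := hpos 1 1 one_pos one_pos
      linarith
    have h1 := hmin z₀ (mem_region_of_mem_monoPoints hz₀ q₀)
    rw [← ha] at h1
    have h2 := hz₀min q₀ z hzR
    have h3 : z.2 ≤ z₀.2 := le_of_mul_le_mul_right (by linarith) hb'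
    rw [h2.2 (le_antisymm h3 h2.1)]
    exact ⟨μ, hμ, hface⟩
  · refine ⟨b / a, by positivity, fun w hw => ?_⟩
    have h1 := hmin w (mem_region_of_mem_monoPoints hw q₀)
    refine le_of_mul_le_mul_right ?_ ha
    have h2 : ∀ t : ℝ, b / a * t * a = t * b := fun t => by field_simp
    rw [add_mul, add_mul, h2, h2]
    exact h1

/-- Rotate the supporting line about `z` until it hits a point of larger delay: the new multiplier
`ν` is the steepest slope from `z` to such a point. If there is no such point or `ν` is negative,
`z` has a supporting line with negative multiplier, and no point of the curve lies beyond it. -/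
theorem exists_next_vertex {z : ℝ × ℝ} (hz : z ∈ M.monoPoints) {μ : ℝ}
    (hface : M.OnFace μ z) (hmax : ∀ w ∈ M.monoPoints, M.OnFace μ w → w.2 ≤ z.2) (hμ : 0 ≤ μ) :
    (∀ q₀, ∀ w ∈ M.tradeoffCurve q₀, w.2 ≤ z.2) ∨
    ∃ z' ∈ M.monoPoints, z.2 < z'.2 ∧ Relation.ReflTransGen M.CurveStep z z' ∧
      ∃ μ', 0 ≤ μ' ∧ M.OnFace μ' z' ∧ ∀ w ∈ M.monoPoints, M.OnFace μ' w → w.2 ≤ z'.2 := by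
  have hend : ∀ ν < 0, M.OnFace ν z → ∀ q₀, ∀ w ∈ M.tradeoffCurve q₀, w.2 ≤ z.2 :=
    fun ν hν hzν q₀ w hw => by
      obtain ⟨μ', hμ', hw'⟩ := exists_onFace_of_mem_tradeoffCurve hw
      exact hw'.delay_le hzν hw.1 (mem_region_of_mem_monoPoints hz q₀) (hν.trans_le hμ')
  have hle : ∀ ν ≤ μ, ∀ w ∈ M.monoPoints, w.2 ≤ z.2 → z.1 + ν * z.2 ≤ w.1 + ν * w.2 :=
    fun ν hν w hw hwz => by nlinarith [hface w hw]
  rcases (M.monoPoints ∩ {w | z.2 < w.2}).eq_empty_or_nonempty with hS | hS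
  · refine Or.inl (hend (-1) (by norm_num) fun w hw => hle _ (by linarith) w hw ?_)
    by_contra! h
    exact Set.eq_empty_iff_forall_notMem.1 hS w ⟨hw, h⟩
  obtain ⟨v, ⟨hv, hzv⟩, hvmax⟩ := Set.exists_max_image _ (fun w => (z.1 - w.1) / (w.2 - z.2))
    (finite_monoPoints.subset Set.inter_subset_left) hS
  have hzv' : 0 < v.2 - z.2 := sub_pos.2 hzv
  have hvν : v.1 + (z.1 - v.1) / (v.2 - z.2) * v.2 = z.1 + (z.1 - v.1) / (v.2 - z.2) * z.2 := by
    field_simp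
    ring
  set ν := (z.1 - v.1) / (v.2 - z.2)
  have hνμ : ν < μ := by
    by_contra! h
    have h1 : M.OnFace μ v := fun w hw => by nlinarith [hface w hw]
    exact absurd (hmax v hv h1) (not_le.2 hzv)
  have hzν : M.OnFace ν z := fun w hw => by
    rcases le_or_gt w.2 z.2 with h | h
    · exact hle ν hνμ.le w hw h
    · have h1 := hvmax w ⟨hw, h⟩
      rw [div_le_iff₀ (sub_pos.2 h)] at h1
      linarith
  rcases lt_or_ge ν 0 with hν | hν
  · exact Or.inl (hend ν hν hzν)
  · refine Or.inr ?_
    obtain ⟨lo, hlo, hi, hhi, hloν, hhiν, hpath, hbd⟩ := exists_face_path hν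
    have hR : ∀ {w}, w ∈ M.monoPoints → w ∈ M.region 0 := fun hw => mem_region_of_mem_monoPoints hw 0
    -- The climb on the new face starts at `z`: a larger multiplier means no larger delay, so `z`
    -- has the least delay on this face.
    have h1 : lo = z := hloν.eq_of_delay_eq hzν (hR hlo) (hR hz)
      (le_antisymm (hbd z hz hzν).1 (hface.delay_le hloν (hR hz) (hR hlo) hνμ))
    have h2 : M.OnFace ν v := fun w hw => hvν.le.trans (hzν w hw)
    exact ⟨hi, hhi, lt_of_lt_of_le hzv (hbd v hv h2).2, h1 ▸ hpath, ν, hν, hhiν,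
      fun w hw hwν => (hbd w hw hwν).2⟩

theorem exists_last_vertex {z₀ : ℝ × ℝ} (hz₀ : z₀ ∈ M.monoPoints) {μ : ℝ} (hμ : 0 ≤ μ)
    (hface : M.OnFace μ z₀) (hmax : ∀ w ∈ M.monoPoints, M.OnFace μ w → w.2 ≤ z₀.2) :
    ∃ z, Relation.ReflTransGen M.CurveStep z₀ z ∧ ∀ q₀, ∀ w ∈ M.tradeoffCurve q₀, w.2 ≤ z.2 := by
  let T : Set (ℝ × ℝ) := M.monoPoints ∩ {z | Relation.ReflTransGen M.CurveStep z₀ z ∧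
    ∃ μ, 0 ≤ μ ∧ M.OnFace μ z ∧ ∀ w ∈ M.monoPoints, M.OnFace μ w → w.2 ≤ z.2}
  obtain ⟨z, ⟨hz, hpath, ν, hν, hzν, hzmax⟩, hlast⟩ := Set.exists_max_image T Prod.snd
    (finite_monoPoints.subset Set.inter_subset_left) ⟨z₀, hz₀, .refl, μ, hμ, hface, hmax⟩
  refine ⟨z, hpath, (exists_next_vertex hz hzν hzmax hν).resolve_right ?_⟩
  rintro ⟨z', hz', hlt, hstep, hμ'⟩
  exact absurd (hlast z' ⟨hz', hpath.trans hstep, hμ'⟩) (not_le.2 hlt)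

theorem decreasingCurve_tradeoffCurve (q₀ : M.State) : DecreasingCurve (M.tradeoffCurve q₀) := by
  intro z hz w hw hlt
  obtain ⟨μ, -, hzμ⟩ := exists_onFace_of_mem_tradeoffCurve hz
  obtain ⟨μ', -, hwμ⟩ := exists_onFace_of_mem_tradeoffCurve hw
  have h := (hw.2 z hz.1).resolve_left (not_le.2 hlt)
  refine lt_of_le_of_ne h fun heq => hlt.ne ?_
  rw [hzμ.eq_of_delay_eq hwμ hz.1 hw.1 heq.symm]

/-- A convex combination of curve points lies in the region; `hC` supplies a curve point of the same
power to put below it. -/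
theorem convexCurve_tradeoffCurve {q₀ : M.State}
    (hC : ∀ w ∈ M.tradeoffCurve q₀, ∀ w' ∈ M.tradeoffCurve q₀, ∀ p, w.1 ≤ p → p ≤ w'.1 →
      ∃ v ∈ M.tradeoffCurve q₀, v.1 = p) : ConvexCurve (M.tradeoffCurve q₀) := by
  rintro x ⟨w, hw, hwx, hwx'⟩ y ⟨w', hw', hwy, hwy'⟩ a b ha hb hab
  have huR := convex_region q₀ hw.1 hw'.1 ha hb hab
  have hu1 : (a • w + b • w').1 = (a • x + b • y).1 := by
    simp only [Prod.fst_add, Prod.smul_fst, hwx, hwy]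
  have hu2 : (a • w + b • w').2 ≤ (a • x + b • y).2 := by
    simp only [Prod.snd_add, Prod.smul_snd, smul_eq_mul]
    exact add_le_add (mul_le_mul_of_nonneg_left hwx' ha) (mul_le_mul_of_nonneg_left hwy' hb)
  have hseg : (a • w + b • w').1 ∈ Set.uIcc w.1 w'.1 := by
    rw [← segment_eq_uIcc]
    exact ⟨a, b, ha, hb, hab, by simp⟩
  set u := a • w + b • w'
  obtain ⟨v, hv, hvu⟩ : ∃ v ∈ M.tradeoffCurve q₀, v.1 = u.1 := by
    rcases Set.mem_uIcc.1 hseg with h | h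
    · exact hC w hw w' hw' _ h.1 h.2
    · exact hC w' hw' w hw _ h.1 h.2
  rcases le_or_gt v.2 u.2 with h | h
  · exact ⟨v, hv, hvu.trans hu1, h.trans hu2⟩
  · obtain ⟨μ, hμ, hvμ⟩ := exists_onFace_of_mem_tradeoffCurve hv
    have h1 := hvμ.le_of_mem_region huR
    -- A region point strictly below `v` at equal power forces multiplier zero. Then `u` has minimal
    -- power too and is itself on the curve, which may end in a segment of constant power.
    have hμ0 : μ = 0 := by
      rw [hvu] at h1
      nlinarith
    rw [hμ0] at hvμ
    have huμ : M.OnFace 0 u := fun w hw => by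
      have := hvμ w hw
      rw [hvu] at this
      linarith
    exact ⟨u, huμ.mem_tradeoffCurve le_rfl huR, hu1, hu2⟩

end BufferModel

open BufferModel in
theorem corollary3 (M : BufferModel) :
    (∀ q₀ : M.State, DecreasingCurve (M.tradeoffCurve q₀) ∧ ConvexCurve (M.tradeoffCurve q₀)) ∧
    ∃ (n : ℕ) (z : Fin (n + 1) → ℝ × ℝ),
      -- piecewise linear, with the vertices listed in order along the curve
      (∀ q₀ : M.State, M.tradeoffCurve q₀ = polygonalChain z) ∧
      StrictMono (fun i => (z i).2) ∧ Antitone (fun i => (z i).1) ∧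
      -- the list contains every corner of the curve
      (∀ (q₀ : M.State) (v : ℝ × ℝ), IsCurveCorner (M.tradeoffCurve q₀) v → ∃ i, z i = v) ∧
      -- the vertices are obtained by deterministic policies
      (∀ i, ∃ F : M.DetPolicy, ∀ q₀ : M.State, M.Obtains F.toPolicy q₀ (z i)) ∧
      -- neighbouring vertices are obtained by policies that differ in exactly one state
      (∀ i : Fin n, ∃ F F' : M.DetPolicy,
        (∀ q₀ : M.State, M.Obtains F.toPolicy q₀ (z i.castSucc)) ∧
        (∀ q₀ : M.State, M.Obtains F'.toPolicy q₀ (z i.succ)) ∧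
        F.DifferInOneState F') := by
  obtain ⟨z₀, hz₀, μ₀, hμ₀, hface₀, hmax₀, hmin₀⟩ := exists_min_delay_vertex M
  obtain ⟨z₁, hpath, hlast⟩ := exists_last_vertex hz₀ hμ₀ hface₀ hmax₀
  obtain ⟨n, z, hz0, hz1, hstep⟩ := exists_fin_sequence_of_reflTransGen hpath
  have hvert : ∀ i, z i ∈ M.monoPoints ∧ ∃ μ, 0 ≤ μ ∧ M.OnFace μ (z i) := by
    refine Fin.cases ?_ fun i => ?_
    · rw [hz0]
      exact ⟨hz₀, μ₀, hμ₀, hface₀⟩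
    · obtain ⟨μ, hμ, -, h⟩ := (hstep i).face
      exact ⟨(hstep i).right_mem, μ, hμ, h⟩
  have hvertC : ∀ q₀ i, z i ∈ M.tradeoffCurve q₀ := fun q₀ i => by
    obtain ⟨h, μ, hμ, hf⟩ := hvert i
    exact hf.mem_tradeoffCurve hμ (mem_region_of_mem_monoPoints h q₀)
  have hsegC : ∀ q₀ (i : Fin n), segment ℝ (z i.castSucc) (z i.succ) ⊆ M.tradeoffCurve q₀ :=
    fun q₀ i v hv => by
      obtain ⟨μ, hμ, h, h'⟩ := (hstep i).face
      exact (h.mem_segment h' hv).mem_tradeoffCurve hμ ((convex_region q₀).segment_subset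
        (hvertC q₀ _).1 (hvertC q₀ _).1 hv)
  have hchain : ∀ q₀, M.tradeoffCurve q₀ = polygonalChain z := fun q₀ => by
    refine Set.Subset.antisymm (fun w hw => ?_)
      (Set.union_subset (Set.range_subset_iff.2 (hvertC q₀)) (Set.iUnion_subset (hsegC q₀)))
    obtain ⟨μ, hμ, hwμ⟩ := exists_onFace_of_mem_tradeoffCurve hw
    rcases Fin.eq_or_exists_between (fun i => (z i).2) (p := w.2)
      (by rw [hz0]; exact (hmin₀ q₀ w hw.1).1) (by rw [hz1]; exact hlast q₀ w hw) with h | ⟨i, h, h'⟩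
    · rw [hz0] at h
      exact Or.inl ⟨0, hz0.trans ((hmin₀ q₀ w hw.1).2 h).symm⟩
    -- The point of the chain with the delay of `w` must be `w`, as both lie on supporting lines.
    · obtain ⟨v, hv, hvw⟩ := exists_mem_segment_map_eq (LinearMap.snd ℝ ℝ ℝ) h h'
      obtain ⟨μ', -, hvμ⟩ := exists_onFace_of_mem_tradeoffCurve (hsegC q₀ i hv)
      rw [← hvμ.eq_of_delay_eq hwμ (hsegC q₀ i hv).1 hw.1 hvw]
      exact Or.inr (Set.mem_iUnion.2 ⟨i, hv⟩)
  have hpower : ∀ q₀, ∀ w ∈ M.tradeoffCurve q₀, z₁.1 ≤ w.1 ∧ w.1 ≤ z₀.1 := fun q₀ w hw => by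
    obtain ⟨μ, hμ, hwμ⟩ := exists_onFace_of_mem_tradeoffCurve hw
    obtain ⟨-, μ', hμ', h'⟩ := hvert (Fin.last n)
    rw [hz1] at h'
    have h1 := hwμ z₀ hz₀
    have h2 := h'.le_of_mem_region hw.1
    have h3 := mul_le_mul_of_nonneg_left (hlast q₀ w hw) hμ'
    have h4 := mul_le_mul_of_nonneg_left (hmin₀ q₀ w hw.1).1 hμ
    exact ⟨by linarith, by linarith⟩
  refine ⟨fun q₀ => ⟨decreasingCurve_tradeoffCurve q₀, convexCurve_tradeoffCurve ?_⟩,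
    n, z, hchain, ?_, ?_, ?_, ?_, ?_⟩
  · intro w hw w' hw' p hp hp'
    -- The signs are changed because powers decrease along the chain.
    rcases Fin.eq_or_exists_between (fun i => -(z i).1) (p := -p)
      (by rw [hz0]; linarith [(hpower q₀ w' hw').2])
      (by rw [hz1]; linarith [(hpower q₀ w hw).1]) with h | ⟨i, h, h'⟩
    · exact ⟨z 0, hvertC q₀ 0, (neg_injective h).symm⟩
    · obtain ⟨v, hv, hvp⟩ := exists_mem_segment_map_eq (-LinearMap.fst ℝ ℝ ℝ) h h'
      exact ⟨v, hsegC q₀ i hv, neg_injective hvp⟩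
  · exact Fin.strictMono_iff_lt_succ.2 fun i => (hstep i).delay_lt
  · refine Fin.antitone_iff_succ_le.2 fun i => ?_
    obtain ⟨μ, hμ, -, h⟩ := (hstep i).face
    have h1 := h _ (hvert i.castSucc).1
    have h2 := mul_le_mul_of_nonneg_left (hstep i).delay_lt.le hμ
    linarith
  · rintro q₀ v ⟨hv, hcorner⟩
    have hv' := hv
    rw [hchain q₀] at hv'
    rcases hv' with h | h
    · exact h
    · obtain ⟨i, hi⟩ := Set.mem_iUnion.1 h
      by_contra! hne
      have h1 := hcorner _ _ (hsegC q₀ i)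
        (mem_openSegment_of_ne_left_right (hne _) (hne _) hi)
      exact (hstep i).delay_lt.ne (by rw [h1])
  · exact fun i => exists_policy_of_mem_monoPoints (hvert i).1
  · exact fun i => (hstep i).policies
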